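/- For $n\ge 0$ let $\mathcal X_{2n}$ be the set of even-odd descent permutations of $[2n]$, i.e. permutations $\sigma=\sigma_1\cdots\sigma_{2n}$ such that $\sigma_i$ is even and $\sigma_{i+1}$ is odd whenever $\sigma_i>\sigma_{i+1}$. For such a descent, $\sigma_i$ is called a descent top and $\sigma_{i+1}$ a descent bottom. For $\sigma\in\mathcal X_{2n}$ let $\mathrm{des}\,\sigma$ be the number of descents; $\mathrm{lema}\,\sigma$, $\mathrm{loma}\,\sigma$ the numbers of even, respectively odd, left-to-right maxima; $\mathrm{remi}\,\sigma$, $\mathrm{romi}\,\sigma$ the numbers of even, respectively odd, right-to-left minima; $\mathrm{les}\,\sigma$ the number of pairs $(i,j)$ with $2\le i<j\le 2n$ and $\sigma_{i-1}>\sigma_j>\sigma_i$; $\mathrm{res}\,\sigma$ the number of pairs $(i,j)$ with $1\le i<j\le 2n-1$ and $\sigma_j>\sigma_i>\sigma_{j+1}$; and $\mathrm{dom}\,\sigma$ the number of $j\in[n]$ such that $2j$ is a descent top and $2j-1$ is a descent bottom of $\sigma$. Put $$X_n(a,\bar a,b,\bar b,p,q,y,t)=\sum_{\sigma\in\mathcal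 X_{2n}}a^{\mathrm{lema}\,\sigma}\bar a^{\mathrm{loma}\,\sigma}b^{\mathrm{romi}\,\sigma}\bar b^{\mathrm{remi}\,\sigma}p^{\mathrm{res}\,\sigma}q^{\mathrm{les}\,\sigma}y^{\mathrm{dom}\,\sigma}t^{\mathrm{des}\,\sigma}.$$ An even-odd descent permutation $\sigma$ is an $\mathcal E$-permutation if for no $j\in[n]$ the entries $2j-1$ and $2j$ are simultaneously a descent bottom and a descent top of $\sigma$; let $\overline{\mathcal X}_{2n,k}$ be the set of $\mathcal E$-permutations in $\mathcal X_{2n}$ with exactly $k$ descents. For $n\ge1$ let $$[x,n]_{p,q}=xp^{n-1}+\sum_{i=1}^{n-1}p^{n-1-i}q^i .$$ **Theorem.** As formal power series in $x$, $$1+\sum_{n\ge1}X_n(a,1,b,1,p,q,y,t)\,x^n=\cfrac{1}{1-b_0x-\cfrac{\lambda_1x^2}{1-b_1x-\cfrac{\lambda_2x^2}{1-b_2x-\cdots}}}$$ with, for $n\ge1$, $$b_{n-1}=(1+ty)\,[a,n]_{p,q}\,[b,n]_{q,p},\qquad \lambda_n=t\,[a,n]_{p,q}\,[a,n+1]_{p,q}\,[b,n]_{q,p}\,[b,n+1]_{q,p}.$$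 Moreover, for all $n\ge0$, $$X_n(a,1,b,1,p,q,y,t)=\sum_{k=0}^{\lfloor n/2\rfloor}\gamma_{n,k}(a,b,p,q)\,t^k(1+yt)^{n-2k},$$ where $$\gamma_{n,k}(a,b,p,q)=\sum_{\sigma\in\overline{\mathcal X}_{2n,k}}a^{\mathrm{lema}\,\sigma}b^{\mathrm{romi}\,\sigma}p^{\mathrm{res}\,\sigma}q^{\mathrm{les}\,\sigma}.$$ -/

import Mathlib

/-! Even-odd descent permutations of `[2n]`, their statistics, and formal J-fractions.

A permutation `σ` of `[m] = {1, …, m}` is an element of `Equiv.Perm (Fin m)`, read as the word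
`σ₁ σ₂ … σₘ`; positions and letters are both shifted by one, see `letter`. -/

namespace EvenOdd

open Finset PowerSeries

section Words

variable {m : ℕ}

/-- The letter, an element of `{1, …, m}`, of the word of `σ` at position `i`. -/
def letter (σ : Equiv.Perm (Fin m)) (i : Fin m) : ℕ := (σ i : ℕ) + 1

/-- `i`, `j` are consecutive positions (in this order) and `(σᵢ, σⱼ)` is a descent of `σ`. -/
def IsDescent (σ : Equiv.Perm (Fin m)) (i j : Fin m) : Prop :=
  (i : ℕ) + 1 = j ∧ letter σ j < letter σ i

instance (σ : Equiv.Perm (Fin m)) (i j : Fin m) : Decidable (IsDescent σ i j) := by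
  unfold IsDescent; infer_instance

/-- The number of descents. -/
def des (σ : Equiv.Perm (Fin m)) : ℕ :=
  #{x : Fin m × Fin m | IsDescent σ x.1 x.2}

/-- The value `v` is a descent top of `σ`. -/
def IsDescentTop (σ : Equiv.Perm (Fin m)) (v : ℕ) : Prop :=
  ∃ i j, IsDescent σ i j ∧ letter σ i = v

/-- The value `v` is a descent bottom of `σ`. -/
def IsDescentBottom (σ : Equiv.Perm (Fin m)) (v : ℕ) : Prop :=
  ∃ i j, IsDescent σ i j ∧ letter σ j = v

instance (σ : Equiv.Perm (Fin m)) (v : ℕ) : Decidable (IsDescentTop σ v) := by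
  unfold IsDescentTop; infer_instance

instance (σ : Equiv.Perm (Fin m)) (v : ℕ) : Decidable (IsDescentBottom σ v) := by
  unfold IsDescentBottom; infer_instance

/-- The letter at position `i` is a left-to-right maximum. -/
def IsLRMax (σ : Equiv.Perm (Fin m)) (i : Fin m) : Prop :=
  ∀ j, j < i → letter σ j < letter σ i

/-- The letter at position `i` is a right-to-left minimum. -/
def IsRLMin (σ : Equiv.Perm (Fin m)) (i : Fin m) : Prop :=
  ∀ j, i < j → letter σ i < letter σ j

instance (σ : Equiv.Perm (Fin m)) (i : Fin m) : Decidable (IsLRMax σ i) := by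
  unfold IsLRMax; infer_instance

instance (σ : Equiv.Perm (Fin m)) (i : Fin m) : Decidable (IsRLMin σ i) := by
  unfold IsRLMin; infer_instance

/-- The number of even left-to-right maxima. -/
def lema (σ : Equiv.Perm (Fin m)) : ℕ := #{i | IsLRMax σ i ∧ Even (letter σ i)}

/-- The number of odd left-to-right maxima. -/
def loma (σ : Equiv.Perm (Fin m)) : ℕ := #{i | IsLRMax σ i ∧ Odd (letter σ i)}

/-- The number of even right-to-left minima. -/
def remi (σ : Equiv.Perm (Fin m)) : ℕ := #{i | IsRLMin σ i ∧ Even (letter σ i)}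

/-- The number of odd right-to-left minima. -/
def romi (σ : Equiv.Perm (Fin m)) : ℕ := #{i | IsRLMin σ i ∧ Odd (letter σ i)}

/-- The number of pairs `(i, j)` with `2 ≤ i < j ≤ m` and `σᵢ₋₁ > σⱼ > σᵢ`
(`h` is the position `i - 1`). -/
def les (σ : Equiv.Perm (Fin m)) : ℕ :=
  #{x : Fin m × Fin m | x.1 < x.2 ∧
    ∃ h : Fin m, (h : ℕ) + 1 = x.1 ∧ letter σ x.2 < letter σ h ∧ letter σ x.1 < letter σ x.2}

/-- The number of pairs `(i, j)` with `1 ≤ i < j ≤ m - 1` and `σⱼ > σᵢ > σⱼ₊₁`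
(`h` is the position `j + 1`). -/
def res (σ : Equiv.Perm (Fin m)) : ℕ :=
  #{x : Fin m × Fin m | x.1 < x.2 ∧
    ∃ h : Fin m, (x.2 : ℕ) + 1 = h ∧ letter σ x.1 < letter σ x.2 ∧ letter σ h < letter σ x.1}

/-- The number of dominos of `σ`: the `j ∈ [n]` such that `2j` is a descent top and `2j - 1` is a
descent bottom. -/
def dom {n : ℕ} (σ : Equiv.Perm (Fin (2 * n))) : ℕ :=
  #{j ∈ Icc 1 n | IsDescentTop σ (2 * j) ∧ IsDescentBottom σ (2 * j - 1)}

end Words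

/-- The even-odd descent permutations of `[2n]`: every descent has an even top and an odd bottom. -/
def evenOddPerms (n : ℕ) : Finset (Equiv.Perm (Fin (2 * n))) :=
  {σ | ∀ i j, IsDescent σ i j → Even (letter σ i) ∧ Odd (letter σ j)}

/-- The `𝓔`-permutations of `[2n]`: the even-odd descent permutations such that for no `j ∈ [n]`
the entries `2j - 1` and `2j` are simultaneously a descent bottom and a descent top. -/
def ePerms (n : ℕ) : Finset (Equiv.Perm (Fin (2 * n))) :=
  {σ ∈ evenOddPerms n |
    ∀ j ∈ Icc 1 n, ¬ (IsDescentBottom σ (2 * j - 1) ∧ IsDescentTop σ (2 * j))}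

section Polynomials

variable {R : Type*} [CommRing R]

/-- The eight-variable generating polynomial `Xₙ(a, a', b, b', p, q, y, t)` of the even-odd descent
permutations of `[2n]` (`a'`, `b'` stand for the barred letters). -/
def genPoly (n : ℕ) (a a' b b' p q y t : R) : R :=
  ∑ σ ∈ evenOddPerms n, a ^ lema σ * a' ^ loma σ * b ^ romi σ * b' ^ remi σ *
    p ^ res σ * q ^ les σ * y ^ dom σ * t ^ des σ

/-- `γ_{n,k}(a, b, p, q)`: the generating polynomial of the `𝓔`-permutations of `[2n]` with exactly
`k` descents. -/
def gammaCoeff (n k : ℕ) (a b p q : R) : R :=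
  ∑ σ ∈ ePerms n with des σ = k, a ^ lema σ * b ^ romi σ * p ^ res σ * q ^ les σ

/-- The generalized `(p, q)`-integer
`[x, n]_{p,q} = x pⁿ⁻¹ + ∑_{i=1}^{n-1} pⁿ⁻¹⁻ⁱ qⁱ`, for `n ≥ 1`. -/
def pqInt (x : R) (n : ℕ) (p q : R) : R :=
  x * p ^ (n - 1) + ∑ i ∈ Icc 1 (n - 1), p ^ (n - 1 - i) * q ^ i

/-- The finite continued fraction with `h` rows
`1/(1 - βₖ x - λₖ₊₁ x²/(1 - βₖ₊₁ x - ⋯ - λₖ₊ₕ₋₁ x²/(1 - βₖ₊ₕ₋₁ x)))`, a formal power series. All the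
denominators have constant term `1`, so that `invOfUnit _ 1` is the inverse. -/
noncomputable def jConvergent (β lam : ℕ → R) : ℕ → ℕ → R⟦X⟧
  | 0, _ => 0
  | h + 1, k => invOfUnit
      (1 - C (β k) * X - C (lam (k + 1)) * X ^ 2 * jConvergent β lam h (k + 1)) 1

theorem jConvergent_spec (β lam : ℕ → R) (h k : ℕ) :
    (1 - C (β k) * X - C (lam (k + 1)) * X ^ 2 * jConvergent β lam h (k + 1)) *
      jConvergent β lam (h + 1) k = 1 := by
  rw [jConvergent]
  exact mul_invOfUnit _ 1 (by simp)

/-- The formal power series `F` is the infinite J-fraction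
`1/(1 - β₀ x - λ₁ x²/(1 - β₁ x - λ₂ x²/(1 - β₂ x - ⋯)))`: the finite truncations converge to `F`
coefficientwise, every coefficient being eventually constant. The value `lam 0` plays no role. -/
def HasJFraction (F : R⟦X⟧) (β lam : ℕ → R) : Prop :=
  ∀ n : ℕ, ∀ᶠ h in Filter.atTop, coeff n (jConvergent β lam h 0) = coeff n F

end Polynomials

end EvenOdd

/-! Build a permutation by inserting the letters 1, …, 2n in increasing order. Before m + 1 is
inserted, every maximal block of larger letters is recorded as a single gap `N`. An infinite last
letter is included, so the final block never disappears. `N` is even, so that a gap may be followed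
by an odd smaller letter, and never by an even one or by another gap.

A new odd letter either begins a block, keeping the number c of gaps, or splits one as a descent
bottom, giving c + 1. A new even letter either begins a block or closes a non-final one as a descent
top, giving c - 1. Hence inserting a pair 2j - 1, 2j changes the height c - 1 by at most one, and
the whole construction traces a Motzkin path that returns to height 0.

When a letter is inserted, the gaps on its left and right already determine its share of `les`,
`res` and the extrema. Later insertions only replace a gap by a nonempty word of larger letters,
which does not affect that share (`sameShape_of_mem_insertLetter`). Summing over the choice of the
gap gives a (p, q)-integer for each letter. A level step arises in two ways, neither letter changing
the gaps or the odd one splitting a block and the even one closing a block. The second way has the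
same sum times ty, since it is exactly a domino; this is the factor 1 + ty
(`sum_insertLetter_insertLetter`). Flajolet's correspondence between Motzkin paths and J-fractions
gives the first claim.

For the second claim, a path of length n with k down steps has n - 2k level steps, so `genPoly`
expands in t^k (1 + ty)^(n - 2k) with coefficients free of y and t. At y = 0 only the permutations
without dominos survive, and comparing powers of t identifies the coefficients with `gammaCoeff`. -/

namespace EvenOdd

open Finset PowerSeries

/-! ### Weighted Motzkin paths and J-fractions -/

section Paths

variable {R : Type*} [CommRing R]

/-- The weighted number of Motzkin paths with `n` steps from height `k` to height `0`. At height
`k`, a level step has weight `β k`, an up step `U k`, and a down step to height `k` has weight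
`D k`. -/
def pathSum (β U D : ℕ → R) : ℕ → ℕ → R
  | 0, k => if k = 0 then 1 else 0
  | n + 1, 0 => β 0 * pathSum β U D n 0 + U 0 * pathSum β U D n 1
  | n + 1, k + 1 => β (k + 1) * pathSum β U D n (k + 1) + U (k + 1) * pathSum β U D n (k + 2) +
      D k * pathSum β U D n k

/-- The generating series of the paths from height `k` to height `0`. -/
noncomputable def pathSeries (β U D : ℕ → R) (k : ℕ) : R⟦X⟧ :=
  PowerSeries.mk fun n => pathSum β U D n k

/-- The part of `pathSeries` of the paths that are empty or start with a down step. -/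
noncomputable def pathSource (β U D : ℕ → R) : ℕ → R⟦X⟧
  | 0 => 1
  | k + 1 => C (D k) * X * pathSeries β U D k

theorem pathSeries_eq (β U D : ℕ → R) (k : ℕ) :
    pathSeries β U D k = pathSource β U D k + C (β k) * X * pathSeries β U D k +
      C (U k) * X * pathSeries β U D (k + 1) := by
  ext n
  cases n with
  | zero => cases k <;> simp [pathSeries, pathSource, pathSum, mul_assoc]
  | succ n =>
    cases k <;>
      simp [pathSeries, pathSource, pathSum, mul_assoc, coeff_succ_X_mul, coeff_one] <;> ring

/-- The first-step equation at height k involves the series at k + 1, whose source is `D k * X`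
times the series at k. Substituting the approximation at k + 1 produces one more row of the
fraction, and the error gains a factor X from the up step. -/
theorem X_pow_dvd_pathSeries_sub {β lam U D : ℕ → R} (hlam : ∀ k, lam (k + 1) = U k * D k)
    (h k : ℕ) :
    X ^ h ∣ pathSeries β U D k - jConvergent β lam h k * pathSource β U D k := by
  induction h generalizing k with
  | zero => simp
  | succ h ih =>
    have hs := jConvergent_spec β lam h k
    have he := pathSeries_eq β U D k
    have hc : C (lam (k + 1)) = C (U k) * C (D k) := by rw [hlam, map_mul]
    have hr : pathSource β U D (k + 1) = C (D k) * X * pathSeries β U D k := rfl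
    have key : pathSeries β U D k - jConvergent β lam (h + 1) k * pathSource β U D k =
        X * ((pathSeries β U D (k + 1) - jConvergent β lam h (k + 1) * pathSource β U D (k + 1)) *
          (jConvergent β lam (h + 1) k * C (U k))) := by
      rw [hr]
      rw [hc] at hs
      linear_combination jConvergent β lam (h + 1) k * he - pathSeries β U D k * hs
    rw [key, pow_succ']
    exact mul_dvd_mul_left _ ((ih (k + 1)).mul_right _)

theorem hasJFraction_pathSeries {β lam U D : ℕ → R} (hlam : ∀ k, lam (k + 1) = U k * D k) :
    HasJFraction (pathSeries β U D 0) β lam := by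
  intro n
  filter_upwards [Filter.eventually_gt_atTop n] with h hn
  have := X_pow_dvd_iff.mp (X_pow_dvd_pathSeries_sub (β := β) hlam h 0) n hn
  rw [pathSource, mul_one, map_sub, sub_eq_zero] at this
  exact this.symm

/-- The part of `pathSum` of the paths with exactly `j` down steps. -/
def pathCoeff (β U D : ℕ → R) : ℕ → ℕ → ℕ → R
  | 0, k, j => if k = 0 ∧ j = 0 then 1 else 0
  | n + 1, k, j => β k * pathCoeff β U D n k j + U k * pathCoeff β U D n (k + 1) j +
      if k ≠ 0 ∧ j ≠ 0 then D (k - 1) * pathCoeff β U D n (k - 1) (j - 1) else 0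

/-- A path from height k to 0 with j down steps has j - k up steps, so it needs at least 2j - k
steps. -/
theorem pathCoeff_eq_zero (β U D : ℕ → R) {n k j : ℕ} (h : n + k < 2 * j) :
    pathCoeff β U D n k j = 0 := by
  induction n generalizing k j with
  | zero => rw [pathCoeff, if_neg (by omega)]
  | succ n ih =>
    rw [pathCoeff, ih (by omega), ih (by omega)]
    split_ifs with hkj
    · rw [ih (by omega)]; simp
    · simp

/-- With j down steps and j - k up steps, the remaining n + k - 2j steps are level, and each
contributes a factor z. -/
theorem pathSum_eq_sum_pathCoeff (β U D : ℕ → R) (z t : R) {n k J : ℕ} (hJ : n + k < J) :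
    pathSum (fun i => z * β i) U (fun i => t * D i) n k =
      ∑ j ∈ range J, pathCoeff β U D n k j * t ^ j * z ^ (n + k - 2 * j) := by
  induction n generalizing k J with
  | zero =>
    obtain ⟨J, rfl⟩ : ∃ J', J = J' + 1 := ⟨J - 1, by omega⟩
    rw [sum_range_succ']
    by_cases hk : k = 0 <;> simp [pathSum, pathCoeff, hk]
  | succ n ih =>
    have level (k j : ℕ) : β k * pathCoeff β U D n k j * t ^ j * z ^ (n + 1 + k - 2 * j) =
        z * β k * (pathCoeff β U D n k j * t ^ j * z ^ (n + k - 2 * j)) := by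
      -- Truncated subtraction breaks the exponent identity only where the coefficient vanishes.
      by_cases h : n + k < 2 * j
      · simp [pathCoeff_eq_zero β U D h]
      · rw [show n + 1 + k - 2 * j = n + k - 2 * j + 1 by omega]; ring
    have up (k j : ℕ) : U k * pathCoeff β U D n (k + 1) j * t ^ j * z ^ (n + 1 + k - 2 * j) =
        U k * (pathCoeff β U D n (k + 1) j * t ^ j * z ^ (n + (k + 1) - 2 * j)) := by
      rw [show n + 1 + k - 2 * j = n + (k + 1) - 2 * j by omega]; ring
    cases k with
    | zero =>
      rw [pathSum, ih (J := J) (by omega), ih (J := J) (by omega), mul_sum, mul_sum,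
        ← sum_add_distrib]
      refine sum_congr rfl fun j _ => ?_
      rw [pathCoeff, ← level, ← up]
      simp [add_mul]
    | succ k =>
      obtain ⟨J, rfl⟩ : ∃ J', J = J' + 1 := ⟨J - 1, by omega⟩
      rw [pathSum, ih (J := J + 1) (by omega), ih (J := J + 1) (by omega), ih (J := J) (by omega),
        mul_sum, mul_sum, mul_sum, ← sum_add_distrib, sum_range_succ', add_right_comm,
        ← sum_add_distrib, sum_range_succ']
      simp only [pathCoeff, add_mul, ← level, ← up, add_tsub_cancel_right, ne_eq,
        Nat.add_eq_zero_iff, one_ne_zero, and_false, not_false_iff, and_self, if_true]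
      congr 1
      · refine sum_congr rfl fun j _ => ?_
        rw [show n + 1 + (k + 1) - 2 * (j + 1) = n + k - 2 * j by omega]; ring
      · simp

theorem map_pathCoeff {S : Type*} [CommRing S] (f : R →+* S) (β U D : ℕ → R) (n k j : ℕ) :
    f (pathCoeff β U D n k j) =
      pathCoeff (fun i => f (β i)) (fun i => f (U i)) (fun i => f (D i)) n k j := by
  induction n generalizing k j with
  | zero => simp [pathCoeff, apply_ite f]
  | succ n ih =>
    simp [pathCoeff, ih, apply_ite f]

end Paths

/-! ### Gap words: insertion reaches all of them -/

section Gaps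

/-- The pairs `(A, B)` with `s = A ++ N :: B`. -/
def splits (N : ℕ) : List ℕ → List (List ℕ × List ℕ)
  | [] => []
  | x :: l => (if x = N then [([], l)] else []) ++ (splits N l).map fun P => (x :: P.1, P.2)

theorem mem_splits {N : ℕ} {s : List ℕ} {P : List ℕ × List ℕ} :
    P ∈ splits N s ↔ P.1 ++ N :: P.2 = s := by
  induction s generalizing P with
  | nil => simp [splits]
  | cons x l ih =>
    obtain ⟨A, B⟩ := P
    rw [splits, List.mem_append, List.mem_map]
    constructor
    · rintro (h | ⟨Q, hQ, h⟩)
      · split_ifs at h with hx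
        · simp only [List.mem_singleton, Prod.mk.injEq] at h
          simp [h.1, h.2, hx]
        · simp at h
      · rw [ih] at hQ
        simp only [Prod.mk.injEq] at h
        simp [← h.1, ← h.2, hQ]
    · intro h
      cases A with
      | nil =>
        simp only [List.nil_append, List.cons.injEq] at h
        left; simp [h.1, h.2]
      | cons z A =>
        simp only [List.cons_append, List.cons.injEq] at h
        exact Or.inr ⟨(A, B), ih.2 h.2, by simp [h.1]⟩

theorem nodup_splits (N : ℕ) (s : List ℕ) : (splits N s).Nodup := by
  induction s with
  | nil => simp [splits]
  | cons x l ih =>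
    rw [splits, List.nodup_append]
    refine ⟨by split_ifs <;> simp, ih.map ?_, ?_⟩
    · rintro ⟨A, B⟩ ⟨A', B'⟩ h
      simpa using h
    · intro P hP Q hQ h
      obtain ⟨Q', -, rfl⟩ := List.mem_map.1 hQ
      split_ifs at hP with hx
      · simp only [List.mem_singleton] at hP
        simp [hP] at h
      · simp at hP

/-- Numbering the gaps from 0, the i-th one has i gaps on its left and all the others on its right.
This turns a sum over insertion places into a sum over i. -/
theorem sum_splits {R : Type*} [CommRing R] (N : ℕ) (s : List ℕ) (f : ℕ → ℕ → R) :
    ((splits N s).map fun P => f (P.1.count N) (P.2.count N)).sum =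
      ∑ i ∈ range (s.count N), f i (s.count N - 1 - i) := by
  induction s generalizing f with
  | nil => simp [splits]
  | cons x l ih =>
    by_cases hx : x = N
    · subst hx
      have := ih fun i j => f (i + 1) j
      simp only [splits, if_true, List.map_append, List.map_map, List.sum_append,
        Function.comp_def, List.count_cons_self, List.map_cons, List.map_nil, List.sum_cons,
        List.sum_nil, List.count_nil, this, sum_range_succ' _ (l.count x)]
      rw [add_comm]
      congr 1
      · exact sum_congr rfl fun i _ => by congr 1; omega
      · simp
    · simp [splits, hx, ih, Function.comp_def]

/-- The number of pairs of adjacent letters `x`, `y` (in this order) with `x > v > y`. -/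
def crossings (v : ℕ) : List ℕ → ℕ
  | [] => 0
  | x :: l => (if v < x ∧ ∃ y ∈ l.head?, y < v then 1 else 0) + crossings v l

/-- The admissible adjacencies. -/
def Adj (x y : ℕ) : Prop := x < y ∨ (Even x ∧ Odd y)

/-- `s` is a word with the letters `1, …, m`, each of them once, and with gaps, represented by the
letter `N`, such that the last letter is a gap and the descents are from an even letter to an odd
one. -/
structure IsGapWord (N m : ℕ) (s : List ℕ) : Prop where
  chain : s.IsChain Adj
  count_eq : ∀ v, 1 ≤ v → v ≤ m → s.count v = 1
  mem_bound : ∀ x ∈ s, (1 ≤ x ∧ x ≤ m) ∨ x = N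
  last : ∃ s', s = s' ++ [N]

/-- The gap words obtained from `s` by inserting the letter `v`, which does not become a descent
bottom or a descent top. -/
def insertInner (N v : ℕ) (s : List ℕ) : List (List ℕ) :=
  (splits N s).map fun P => P.1 ++ v :: N :: P.2

/-- The gap words obtained from `s` by inserting the letter `v` as a descent bottom. -/
def insertBottom (N v : ℕ) (s : List ℕ) : List (List ℕ) :=
  (splits N s).map fun P => P.1 ++ N :: v :: N :: P.2

/-- The gap words obtained from `s` by inserting the letter `v` as a descent top. -/
def insertTop (N v : ℕ) (s : List ℕ) : List (List ℕ) :=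
  ((splits N s).filter fun P => P.2.count N ≠ 0).map fun P => P.1 ++ v :: P.2

/-- The gap words obtained from `s` by inserting the letter `v`. -/
def insertLetter (N v : ℕ) (s : List ℕ) : List (List ℕ) :=
  insertInner N v s ++ if Even v then insertTop N v s else insertBottom N v s

/-- The gap words with the letters `1, …, m`. -/
def gapWords (N : ℕ) : ℕ → List (List ℕ)
  | 0 => [[N]]
  | m + 1 => (gapWords N m).flatMap (insertLetter N (m + 1))

theorem mem_insertLetter {N v : ℕ} {s s' : List ℕ} :
    s' ∈ insertLetter N v s ↔ ∃ A B, s = A ++ N :: B ∧ (s' = A ++ v :: N :: B ∨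
      (Even v ∧ B.count N ≠ 0 ∧ s' = A ++ v :: B) ∨ (¬ Even v ∧ s' = A ++ N :: v :: N :: B)) := by
  unfold insertLetter
  by_cases hv : Even v <;>
    simp only [hv, if_true, if_false, List.mem_append, insertInner, insertTop, insertBottom,
      List.mem_map, mem_splits, List.mem_filter, Prod.exists, decide_eq_true_eq, not_true,
      false_and, or_false, true_and, not_false_iff, false_or]
  · constructor
    · rintro (⟨A, B, h, rfl⟩ | ⟨A, B, ⟨h, hB⟩, rfl⟩)
      · exact ⟨A, B, h.symm, Or.inl rfl⟩
      · exact ⟨A, B, h.symm, Or.inr ⟨hB, rfl⟩⟩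
    · rintro ⟨A, B, h, h' | ⟨hB, h'⟩⟩
      · exact Or.inl ⟨A, B, h.symm, h'.symm⟩
      · exact Or.inr ⟨A, B, ⟨h.symm, hB⟩, h'.symm⟩
  · constructor
    · rintro (⟨A, B, h, rfl⟩ | ⟨A, B, h, rfl⟩)
      · exact ⟨A, B, h.symm, Or.inl rfl⟩
      · exact ⟨A, B, h.symm, Or.inr rfl⟩
    · rintro ⟨A, B, h, h' | h'⟩
      · exact Or.inl ⟨A, B, h.symm, h'.symm⟩
      · exact Or.inr ⟨A, B, h.symm, h'.symm⟩

theorem exists_eq_append_singleton_of_suffix {N : ℕ} {A B s' : List ℕ} (hB : B ≠ [])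
    (h : A ++ B = s' ++ [N]) : ∃ B', B = B' ++ [N] := by
  refine ⟨B.dropLast, ?_⟩
  have h1 := congrArg List.getLast? h
  rw [List.getLast?_append_of_ne_nil _ hB, List.getLast?_concat] at h1
  rw [List.dropLast_append_getLast? N h1]

namespace IsGapWord

variable {N m : ℕ} {s s' A B : List ℕ}

theorem suffix_last (hs : IsGapWord N m (A ++ B)) (hB : B ≠ []) : ∃ B', B = B' ++ [N] := by
  obtain ⟨s', h⟩ := hs.last
  exact exists_eq_append_singleton_of_suffix hB h

theorem adj_left (hN : Even N) (hs : IsGapWord N m (A ++ N :: B)) {x : ℕ}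
    (hx : x ∈ A.getLast?) : 1 ≤ x ∧ x ≤ m := by
  have h := (List.isChain_append.1 hs.chain).2.2 x hx N (by simp)
  rcases hs.mem_bound x (List.mem_append_left _ (List.mem_of_mem_getLast? hx)) with h' | rfl
  · exact h'
  · simp only [Adj, lt_irrefl, false_or] at h
    exact absurd hN (Nat.not_even_iff_odd.2 h.2)

/-- Whatever follows a gap cannot be larger than `N`, so it must be odd; as `N` is even, it is a
letter and not a gap. -/
theorem adj_right (hN : Even N) (hmN : m < N) (hs : IsGapWord N m (A ++ N :: B)) {y : ℕ}
    (hy : y ∈ B.head?) : 1 ≤ y ∧ y ≤ m ∧ Odd y := by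
  have h := (List.isChain_cons.1 (List.isChain_append.1 hs.chain).2.1).1 y hy
  have hyB : y ∈ A ++ N :: B := by
    simp [List.mem_of_mem_head? hy]
  rcases hs.mem_bound y hyB with h' | rfl
  · rcases h with h | h
    · omega
    · exact ⟨h'.1, h'.2, h.2⟩
  · simp only [Adj, lt_irrefl, false_or] at h
    exact absurd hN (Nat.not_even_iff_odd.2 h.2)

theorem of_mem_insertLetter (hN : Even N) (hmN : m + 1 < N) (hs : IsGapWord N m s)
    (hs' : s' ∈ insertLetter N (m + 1) s) : IsGapWord N (m + 1) s' := by
  obtain ⟨A, B, rfl, h⟩ := mem_insertLetter.1 hs'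
  have hl := fun x hx => hs.adj_left hN (x := x) hx
  have hr := fun y hy => hs.adj_right hN (by omega) (y := y) hy
  have hc := hs.chain
  have hm1 : (m + 1) ∉ A ++ N :: B := fun h => by
    rcases hs.mem_bound _ h with h | h <;> omega
  have hcA : A.count (m + 1) = 0 := List.count_eq_zero.2 fun h => hm1 (by simp [h])
  have hcB : B.count (m + 1) = 0 := List.count_eq_zero.2 fun h => hm1 (by simp [h])
  have hcount : ∀ v, 1 ≤ v → v ≤ m → A.count v + B.count v = 1 := fun v h1 h2 => by
    have := hs.count_eq v h1 h2
    rwa [List.count_append, List.count_cons_of_ne (by omega)] at this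
  have hbA : ∀ x ∈ A, (1 ≤ x ∧ x ≤ m) ∨ x = N := fun x hx => hs.mem_bound x (by simp [hx])
  have hbB : ∀ x ∈ B, (1 ≤ x ∧ x ≤ m) ∨ x = N := fun x hx => hs.mem_bound x (by simp [hx])
  rw [List.isChain_append, List.isChain_cons] at hc
  obtain ⟨hcA', ⟨hcN, hcB'⟩, -⟩ := hc
  obtain ⟨B', hB'⟩ := hs.suffix_last (by simp)
  have hAv : ∀ x ∈ A.getLast?, Adj x (m + 1) := fun x hx => Or.inl (by have := hl x hx; omega)
  have hAN : ∀ x ∈ A.getLast?, Adj x N := fun x hx => Or.inl (by have := hl x hx; omega)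
  have hvN : Adj (m + 1) N := Or.inl hmN
  have hN1 : N ≠ m + 1 := by omega
  have hNv : ∀ v ≤ m, N ≠ v := fun v h => by omega
  have hmv : ∀ v ≤ m, m + 1 ≠ v := fun v h => by omega
  rcases h with rfl | ⟨hv, hB, rfl⟩ | ⟨hv, rfl⟩
  · refine ⟨?_, ?_, ?_, A ++ (m + 1) :: B', by simp [hB']⟩
    · simpa [List.isChain_append, List.isChain_cons, hcA', hcB', hvN] using ⟨hcN, hAv⟩
    · intro v h1 h2
      rcases Nat.lt_or_ge m v with h | h
      · obtain rfl : v = m + 1 := by omega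
        simp [hcA, hcB, hN1]
      · simpa [List.count_cons, hNv v h, hmv v h] using hcount v h1 h
    · intro x hx
      simp only [List.mem_append, List.mem_cons] at hx
      rcases hx with h | h | h | h <;>
        first | omega | (have := hbA x h; omega) | (have := hbB x h; omega)
  · have hBne : B ≠ [] := by rintro rfl; simp at hB
    obtain ⟨B'', hB''⟩ : ∃ B'', B = B'' ++ [N] :=
      IsGapWord.suffix_last (A := A ++ [N]) (by simpa using hs) hBne
    refine ⟨?_, ?_, ?_, A ++ (m + 1) :: B'', by simp [hB'']⟩
    · have : ∀ y ∈ B.head?, Adj (m + 1) y := fun y hy => Or.inr ⟨hv, (hr y hy).2.2⟩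
      simpa [List.isChain_append, List.isChain_cons, hcA', hcB'] using ⟨this, hAv⟩
    · intro v h1 h2
      rcases Nat.lt_or_ge m v with h | h
      · obtain rfl : v = m + 1 := by omega
        simp [hcA, hcB]
      · simpa [List.count_cons, hmv v h] using hcount v h1 h
    · intro x hx
      simp only [List.mem_append, List.mem_cons] at hx
      rcases hx with h | h | h <;>
        first | omega | (have := hbA x h; omega) | (have := hbB x h; omega)
  · refine ⟨?_, ?_, ?_, A ++ N :: (m + 1) :: B', by simp [hB']⟩
    · have : Adj N (m + 1) := Or.inr ⟨hN, Nat.not_even_iff_odd.1 hv⟩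
      simpa [List.isChain_append, List.isChain_cons, hcA', hcB', hvN, this] using ⟨hcN, hAN⟩
    · intro v h1 h2
      rcases Nat.lt_or_ge m v with h | h
      · obtain rfl : v = m + 1 := by omega
        simp [hcA, hcB, hN1]
      · simpa [List.count_cons, hNv v h, hmv v h] using hcount v h1 h
    · intro x hx
      simp only [List.mem_append, List.mem_cons] at hx
      rcases hx with h | h | h | h | h <;>
        first | omega | (have := hbA x h; omega) | (have := hbB x h; omega)

/-- The neighbours of m + 1 tell how it was inserted. Between two gaps it is a bottom, and the gaps
merge on removal. If only the next entry is a gap, it began that block. If a smaller letter follows,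
it closed a block, which is restored as a gap. -/
theorem exists_mem_insertLetter (hN : Even N) (hmN : m + 1 < N) (hs : IsGapWord N (m + 1) s') :
    ∃ s, IsGapWord N m s ∧ s' ∈ insertLetter N (m + 1) s := by
  have hmem : m + 1 ∈ s' := List.count_pos_iff.1 (by rw [hs.count_eq _ (by omega) le_rfl]; simp)
  obtain ⟨A, B, rfl⟩ := List.append_of_mem hmem
  have hcount := hs.count_eq
  have hb := hs.mem_bound
  have hc0 := hcount (m + 1) (by omega) le_rfl
  simp only [List.count_append, List.count_cons_self] at hc0
  have hvA : (m + 1) ∉ A := List.count_eq_zero.1 (by omega)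
  have hvB : (m + 1) ∉ B := List.count_eq_zero.1 (by omega)
  have hcAB : ∀ v, 1 ≤ v → v ≤ m → A.count v + B.count v = 1 := fun v h1 h2 => by
    have := hcount v h1 (by omega)
    rwa [List.count_append, List.count_cons_of_ne (by omega)] at this
  have hbA : ∀ x ∈ A, (1 ≤ x ∧ x ≤ m) ∨ x = N := fun x hx => by
    have h1 := hb x (by simp [hx])
    have h2 : x ≠ m + 1 := fun h => hvA (h ▸ hx)
    omega
  have hbB : ∀ x ∈ B, (1 ≤ x ∧ x ≤ m) ∨ x = N := fun x hx => by
    have h1 := hb x (by simp [hx])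
    have h2 : x ≠ m + 1 := fun h => hvB (h ▸ hx)
    omega
  have hc := hs.chain
  rw [List.isChain_append, List.isChain_cons] at hc
  obtain ⟨hcA', ⟨hcv, hcB'⟩, hAv⟩ := hc
  replace hAv : ∀ x ∈ A.getLast?, Adj x (m + 1) := by simpa using hAv
  have hBne : B ≠ [] := by
    rintro rfl
    obtain ⟨s', h⟩ := hs.last
    have := congrArg List.getLast? h
    simp at this
    omega
  obtain ⟨B', hB'⟩ : ∃ B', B = B' ++ [N] :=
    IsGapWord.suffix_last (A := A ++ [m + 1]) (by simpa using hs) hBne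
  have mk (A B : List ℕ) (hc : (A ++ N :: B).IsChain Adj)
      (hcount : ∀ v, 1 ≤ v → v ≤ m → A.count v + B.count v = 1)
      (hA : ∀ x ∈ A, (1 ≤ x ∧ x ≤ m) ∨ x = N) (hB : ∀ x ∈ B, (1 ≤ x ∧ x ≤ m) ∨ x = N)
      (hl : ∃ s', A ++ N :: B = s' ++ [N]) : IsGapWord N m (A ++ N :: B) := by
    refine ⟨hc, fun v h1 h2 => ?_, fun x hx => ?_, hl⟩
    swap
    · simp only [List.mem_append, List.mem_cons] at hx
      rcases hx with h | h | h
      exacts [hA x h, Or.inr h, hB x h]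
    rw [List.count_append, List.count_cons_of_ne (by omega), hcount v h1 h2]
  -- A gap before m + 1 makes m + 1 a descent bottom, hence odd.
  have hlast : ∀ x ∈ A.getLast?, x = N → ¬ Even (m + 1) := by
    rintro x hx rfl hv
    rcases hAv x hx with h | h
    · omega
    · exact Nat.not_even_iff_odd.2 h.2 hv
  obtain ⟨y, C, rfl⟩ := List.exists_cons_of_ne_nil hBne
  have hAN (h : N ∉ A.getLast?) : ∀ x ∈ A.getLast?, Adj x N := fun x hx => by
    rcases hbA x (List.mem_of_mem_getLast? hx) with h' | rfl
    · exact Or.inl (by omega)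
    · exact absurd hx h
  by_cases hy : y = N
  · subst hy
    by_cases hA : y ∈ A.getLast?
    · obtain ⟨A', rfl⟩ : ∃ A', A = A' ++ [y] := ⟨A.dropLast, by
        rw [List.dropLast_append_getLast? y hA]⟩
      refine ⟨A' ++ y :: C, mk A' C ?_ ?_ (fun x hx => hbA x (by simp [hx]))
        (fun x hx => hbB x (by simp [hx])) ?_,
        mem_insertLetter.2 ⟨A', C, rfl, Or.inr <| Or.inr ⟨hlast y hA rfl, by simp⟩⟩⟩
      · rw [List.isChain_append] at hcA' ⊢
        exact ⟨hcA'.1, hcB', by simpa using hcA'.2.2⟩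
      · intro v h1 h2
        have := hcAB v h1 h2
        have hyv : y ≠ v := by omega
        simpa [List.count_cons, hyv] using this
      · exact ⟨A' ++ B', by simp [hB']⟩
    · refine ⟨A ++ y :: C, mk A C ?_ ?_ hbA (fun x hx => hbB x (by simp [hx])) ?_,
        mem_insertLetter.2 ⟨A, C, rfl, Or.inl rfl⟩⟩
      · rw [List.isChain_append]
        exact ⟨hcA', hcB', by simpa using hAN hA⟩
      · intro v h1 h2
        have := hcAB v h1 h2
        have hyv : y ≠ v := by omega
        simpa [List.count_cons, hyv] using this
      · exact ⟨A ++ B', by simp [hB']⟩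
  -- Here m + 1 is a descent top, hence even, so no gap precedes it and a gap can take its place.
  · have hym : 1 ≤ y ∧ y ≤ m := (hbB y (by simp)).resolve_right hy
    have hvy : Even (m + 1) ∧ Odd y := (hcv y (by simp)).resolve_left (by omega)
    refine ⟨A ++ N :: y :: C, mk A (y :: C) ?_ hcAB hbA hbB ?_,
        mem_insertLetter.2 ⟨A, y :: C, rfl, Or.inr <| Or.inl ⟨hvy.1, ?_, rfl⟩⟩⟩
    · rw [List.isChain_append, List.isChain_cons]
      refine ⟨hcA', ⟨?_, hcB'⟩, ?_⟩
      · simpa using show Adj N y from Or.inr ⟨hN, hvy.2⟩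
      · simpa using hAN fun h => hlast N h rfl hvy.1
    · exact ⟨A ++ N :: B', by simp [hB']⟩
    · simp [hB']

end IsGapWord

theorem mem_gapWords {N m : ℕ} (hN : Even N) (hmN : m < N) {s : List ℕ} :
    s ∈ gapWords N m ↔ IsGapWord N m s := by
  induction m generalizing s with
  | zero =>
    rw [gapWords, List.mem_singleton]
    constructor
    · rintro rfl
      exact ⟨by simp, by omega, by simp, [], by simp⟩
    · intro h
      obtain ⟨s', rfl⟩ := h.last
      rcases List.eq_nil_or_concat' s' with rfl | ⟨L, x, rfl⟩
      · rfl
      · have h1 := IsGapWord.adj_left (A := L ++ [x]) (B := []) hN h (x := x) (by simp)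
        omega
  | succ m ih =>
    rw [gapWords, List.mem_flatMap]
    constructor
    · rintro ⟨s', hs', h⟩
      exact ((ih (by omega)).1 hs').of_mem_insertLetter hN hmN h
    · intro h
      obtain ⟨s', hs', h'⟩ := h.exists_mem_insertLetter hN hmN
      exact ⟨s', (ih (by omega)).2 hs', h'⟩

end Gaps

/-! ### Insertion reaches each gap word only once -/

section Gaps

theorem not_adj_self {x : ℕ} : ¬ Adj x x := by
  rintro (h | ⟨h, h'⟩)
  · exact lt_irrefl _ h
  · exact Nat.not_even_iff_odd.2 h' h

namespace IsGapWord

variable {N m : ℕ} {s s' A B A' B' : List ℕ}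

theorem notMem_succ (hmN : m + 1 < N) (hs : IsGapWord N m s) : m + 1 ∉ s := fun h => by
  rcases hs.mem_bound _ h with h | h <;> omega

/-- The letter m + 1 is absent from the old word, so it marks a unique cutting place in the new one.
-/
theorem append_eq_append (hmN : m + 1 < N) (hs : IsGapWord N m (A ++ N :: B))
    {C C' : List ℕ} (hC : C ⊆ N :: B) (h : A ++ (m + 1) :: C = A' ++ (m + 1) :: C') :
    A = A' ∧ C = C' := by
  have h0 := hs.notMem_succ hmN
  have := (List.append_cons_inj_of_notMem (fun h => h0 (List.mem_append_left _ h))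
    (fun h => h0 (List.mem_append_right _ (hC h)))).1 h
  exact ⟨this.1, this.2.2⟩

theorem inner_inj (hmN : m + 1 < N) (hs : IsGapWord N m (A ++ N :: B))
    (h : A ++ (m + 1) :: N :: B = A' ++ (m + 1) :: N :: B') : A = A' ∧ B = B' := by
  have := hs.append_eq_append hmN (List.Subset.refl _) h
  exact ⟨this.1, (List.cons.inj this.2).2⟩

theorem top_inj (hmN : m + 1 < N) (hs : IsGapWord N m (A ++ N :: B))
    (h : A ++ (m + 1) :: B = A' ++ (m + 1) :: B') : A = A' ∧ B = B' :=
  hs.append_eq_append hmN (List.subset_cons_self _ _) h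

theorem bottom_inj (hmN : m + 1 < N) (hs : IsGapWord N m (A ++ N :: B))
    (h : A ++ N :: (m + 1) :: N :: B = A' ++ N :: (m + 1) :: N :: B') : A = A' ∧ B = B' := by
  have h0 := hs.notMem_succ hmN
  have h1 : (A ++ [N]) ++ (m + 1) :: N :: B = (A' ++ [N]) ++ (m + 1) :: N :: B' := by simpa using h
  have := (List.append_cons_inj_of_notMem (fun h => h0 (by simpa [or_assoc] using Or.inl h))
    (fun h => h0 (List.mem_append_right _ h))).1 h1
  exact ⟨List.append_cancel_right this.1, (List.cons.inj this.2.2).2⟩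

/-- A coincidence would put two gaps side by side in the second original word. -/
theorem inner_ne_top (hmN : m + 1 < N) (hs : IsGapWord N m (A ++ N :: B))
    (hs' : IsGapWord N m (A' ++ N :: B')) :
    A ++ (m + 1) :: N :: B ≠ A' ++ (m + 1) :: B' := fun h => by
  obtain ⟨-, rfl⟩ := hs.append_eq_append hmN (List.Subset.refl _) h
  exact not_adj_self ((List.isChain_cons.1 (List.isChain_append.1 hs'.chain).2.1).1 N (by simp))

theorem inner_ne_bottom (hmN : m + 1 < N) (hs : IsGapWord N m (A ++ N :: B)) :
    A ++ (m + 1) :: N :: B ≠ A' ++ N :: (m + 1) :: N :: B' := fun h => by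
  have h1 : A ++ (m + 1) :: N :: B = (A' ++ [N]) ++ (m + 1) :: N :: B' := by simpa using h
  obtain ⟨rfl, -⟩ := hs.append_eq_append hmN (List.Subset.refl _) h1
  exact not_adj_self ((List.isChain_append.1 hs.chain).2.2 N (by simp) N (by simp))

theorem eq_of_mem_insertLetter {r : List ℕ} (hmN : m + 1 < N) (hs : IsGapWord N m s)
    (hs' : IsGapWord N m s') (hr : r ∈ insertLetter N (m + 1) s)
    (hr' : r ∈ insertLetter N (m + 1) s') : s = s' := by
  obtain ⟨A, B, hAB, h⟩ := mem_insertLetter.1 hr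
  obtain ⟨A', B', hAB', h'⟩ := mem_insertLetter.1 hr'
  subst hAB hAB'
  rcases h with rfl | ⟨hv, -, rfl⟩ | ⟨hv, rfl⟩ <;> rcases h' with h' | ⟨hv', -, h'⟩ | ⟨hv', h'⟩
  · obtain ⟨rfl, rfl⟩ := hs.inner_inj hmN h'; rfl
  · exact absurd h' (hs.inner_ne_top hmN hs')
  · exact absurd h' (hs.inner_ne_bottom hmN)
  · exact absurd h'.symm (hs'.inner_ne_top hmN hs)
  · obtain ⟨rfl, rfl⟩ := hs.top_inj hmN h'; rfl
  · exact absurd hv hv'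
  · exact absurd h'.symm (hs'.inner_ne_bottom hmN)
  · exact absurd hv' hv
  · obtain ⟨rfl, rfl⟩ := hs.bottom_inj hmN h'; rfl

theorem nodup_insertLetter (hmN : m + 1 < N) (hs : IsGapWord N m s) :
    (insertLetter N (m + 1) s).Nodup := by
  have hP : ∀ P ∈ splits N s, IsGapWord N m (P.1 ++ N :: P.2) := fun P hP => by
    rwa [mem_splits.1 hP]
  rw [insertLetter, List.nodup_append']
  refine ⟨(nodup_splits N s).map_on fun P h Q h' e => ?_, ?_, ?_⟩
  · exact Prod.ext_iff.2 ((hP P h).inner_inj hmN e)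
  · split_ifs
    · exact ((nodup_splits N s).filter _).map_on fun P h Q h' e =>
        Prod.ext_iff.2 ((hP P (List.mem_of_mem_filter h)).top_inj hmN e)
    · exact (nodup_splits N s).map_on fun P h Q h' e =>
        Prod.ext_iff.2 ((hP P h).bottom_inj hmN e)
  · intro r h h'
    obtain ⟨P, hPs, rfl⟩ := List.mem_map.1 h
    split_ifs at h'
    · obtain ⟨Q, hQ, e⟩ := List.mem_map.1 h'
      exact (hP P hPs).inner_ne_top hmN (hP Q (List.mem_of_mem_filter hQ)) e.symm
    · obtain ⟨Q, hQ, e⟩ := List.mem_map.1 h'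
      exact (hP P hPs).inner_ne_bottom hmN e.symm

end IsGapWord

theorem nodup_gapWords {N m : ℕ} (hN : Even N) (hmN : m < N) : (gapWords N m).Nodup := by
  induction m with
  | zero => simp [gapWords]
  | succ m ih =>
    have hm := fun s => (mem_gapWords hN (m := m) (by omega) (s := s)).1
    rw [gapWords, List.nodup_flatMap]
    refine ⟨fun s hs => (hm s hs).nodup_insertLetter hmN,
      (ih (by omega)).pairwise_of_forall_ne fun s hs s' hs' hne r h h' => hne ?_⟩
    exact (hm s hs).eq_of_mem_insertLetter hmN (hm s' hs') h h'

end Gaps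

/-! ### Weights of single letters and their stability under later insertions -/

section Statistics

/-- The letters to the left of the first occurrence of `v`. -/
def leftPart (v : ℕ) (s : List ℕ) : List ℕ := s.takeWhile (· ≠ v)

/-- The letters to the right of the first occurrence of `v`. -/
def rightPart (v : ℕ) (s : List ℕ) : List ℕ := (s.dropWhile (· ≠ v)).tail

theorem leftPart_append {v : ℕ} {A B : List ℕ} (hv : v ∉ A) : leftPart v (A ++ v :: B) = A := by
  rw [leftPart, List.takeWhile_append_of_pos (by
    intro x hx; simpa using fun h : x = v => hv (h ▸ hx))]
  simp

theorem rightPart_append {v : ℕ} {A B : List ℕ} (hv : v ∉ A) : rightPart v (A ++ v :: B) = B := by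
  rw [rightPart, List.dropWhile_append_of_pos (by
    intro x hx; simpa using fun h : x = v => hv (h ▸ hx))]
  simp

/-- The letter `v` of `s` is followed by a smaller one. -/
def TopIn (v : ℕ) (s : List ℕ) : Prop := ∃ y ∈ (rightPart v s).head?, y < v

/-- The letter `v` of `s` is preceded by a larger one. -/
def BottomIn (v : ℕ) (s : List ℕ) : Prop := ∃ x ∈ (leftPart v s).getLast?, v < x

instance (v : ℕ) (s : List ℕ) : Decidable (TopIn v s) := by unfold TopIn; infer_instance

instance (v : ℕ) (s : List ℕ) : Decidable (BottomIn v s) := by unfold BottomIn; infer_instance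

variable {R : Type*} [CommRing R]

/-- The contribution of the letter `v` to the weight of `s`. -/
def letterWeight (a b p q t : R) (v : ℕ) (s : List ℕ) : R :=
  p ^ crossings v (rightPart v s) * q ^ crossings v (leftPart v s) *
    if Even v then (if ∀ x ∈ leftPart v s, x < v then a else 1) * (if TopIn v s then t else 1)
    else if ∀ x ∈ rightPart v s, v < x then b else 1

/-- The contribution of the letters `2 * j - 1` and `2 * j` as a domino. -/
def dominoWeight (y : R) (j : ℕ) (s : List ℕ) : R :=
  if TopIn (2 * j) s ∧ BottomIn (2 * j - 1) s then y else 1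

/-- The weight of a gap word with the letters `1, …, 2 * m`. -/
def gapWeight (a b p q y t : R) (m : ℕ) (s : List ℕ) : R :=
  (∏ v ∈ Icc 1 (2 * m), letterWeight a b p q t v s) * ∏ j ∈ Icc 1 m, dominoWeight y j s

/-- `L` and `L'` are indistinguishable as far as the position of their letters relative to `v` is
concerned. -/
structure SameShape (v : ℕ) (L L' : List ℕ) : Prop where
  crossings_eq : crossings v L = crossings v L'
  head : (∃ y ∈ L.head?, y < v) ↔ ∃ y ∈ L'.head?, y < v
  last : (∃ x ∈ L.getLast?, v < x) ↔ ∃ x ∈ L'.getLast?, v < x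
  forall_lt : (∀ x ∈ L, x < v) ↔ ∀ x ∈ L', x < v
  forall_gt : (∀ x ∈ L, v < x) ↔ ∀ x ∈ L', v < x

theorem SameShape.refl (v : ℕ) (L : List ℕ) : SameShape v L L :=
  ⟨rfl, Iff.rfl, Iff.rfl, Iff.rfl, Iff.rfl⟩

/-- A block above v can be left downwards only at its end, so only the first letter after the block
matters. -/
theorem crossings_append_of_forall_gt {v : ℕ} {u : List ℕ} (hu : u ≠ []) (hv : ∀ x ∈ u, v < x)
    (B : List ℕ) :
    crossings v (u ++ B) = (if ∃ y ∈ B.head?, y < v then 1 else 0) + crossings v B := by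
  induction u with
  | nil => exact absurd rfl hu
  | cons x u ih =>
    have hx : v < x := hv x (by simp)
    cases u with
    | nil => simp [crossings, hx]
    | cons z u =>
      have hz : ¬ z < v := (hv z (by simp)).le.not_gt
      rw [List.cons_append, crossings, ih (by simp) fun x h => hv x (List.mem_cons_of_mem _ h)]
      simp [hz]

theorem head_append_congr {v : ℕ} {u u' : List ℕ} (hu : u ≠ []) (hv : ∀ x ∈ u, v < x)
    (hu' : u' ≠ []) (hv' : ∀ x ∈ u', v < x) (A B : List ℕ) :
    (∃ y ∈ (A ++ (u ++ B)).head?, y < v) ↔ ∃ y ∈ (A ++ (u' ++ B)).head?, y < v := by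
  cases A with
  | cons x A => simp
  | nil =>
    obtain ⟨x, u, rfl⟩ := List.exists_cons_of_ne_nil hu
    obtain ⟨x', u', rfl⟩ := List.exists_cons_of_ne_nil hu'
    have h1 : ¬ x < v := (hv x (by simp)).le.not_gt
    have h2 : ¬ x' < v := (hv' x' (by simp)).le.not_gt
    simp [h1, h2]

theorem last_append_congr {v : ℕ} {u u' : List ℕ} (hu : u ≠ []) (hv : ∀ x ∈ u, v < x)
    (hu' : u' ≠ []) (hv' : ∀ x ∈ u', v < x) (A B : List ℕ) :
    (∃ y ∈ (A ++ (u ++ B)).getLast?, v < y) ↔ ∃ y ∈ (A ++ (u' ++ B)).getLast?, v < y := by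
  rcases List.eq_nil_or_concat' B with rfl | ⟨B, x, rfl⟩
  · rcases List.eq_nil_or_concat' u with rfl | ⟨u, x, rfl⟩
    · exact absurd rfl hu
    rcases List.eq_nil_or_concat' u' with rfl | ⟨u', x', rfl⟩
    · exact absurd rfl hu'
    have h1 : v < x := hv x (by simp)
    have h2 : v < x' := hv' x' (by simp)
    simp [h1, h2]
  · simp

theorem sameShape_append {v : ℕ} {u u' : List ℕ} (hu : u ≠ []) (hv : ∀ x ∈ u, v < x)
    (hu' : u' ≠ []) (hv' : ∀ x ∈ u', v < x) (A B : List ℕ) :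
    SameShape v (A ++ (u ++ B)) (A ++ (u' ++ B)) := by
  refine ⟨?_, head_append_congr hu hv hu' hv' A B, last_append_congr hu hv hu' hv' A B, ?_, ?_⟩
  · induction A with
    | nil =>
      rw [List.nil_append, List.nil_append, crossings_append_of_forall_gt hu hv,
        crossings_append_of_forall_gt hu' hv']
    | cons x A ih =>
      rw [List.cons_append, List.cons_append, crossings, crossings, ih]
      simp only [head_append_congr hu hv hu' hv' A B]
  · obtain ⟨x, u, rfl⟩ := List.exists_cons_of_ne_nil hu
    obtain ⟨x', u', rfl⟩ := List.exists_cons_of_ne_nil hu'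
    have h1 : ¬ x < v := (hv x (by simp)).le.not_gt
    have h2 : ¬ x' < v := (hv' x' (by simp)).le.not_gt
    constructor
    · intro h; exact absurd (h x (by simp)) h1
    · intro h; exact absurd (h x' (by simp)) h2
  · simp only [List.mem_append]
    constructor
    · rintro h x (hx | hx | hx)
      exacts [h x (Or.inl hx), hv' x hx, h x (Or.inr (Or.inr hx))]
    · rintro h x (hx | hx | hx)
      exacts [h x (Or.inl hx), hv x hx, h x (Or.inr (Or.inr hx))]

theorem sameShape_parts {v : ℕ} {u u' : List ℕ} (hu : u ≠ []) (hv : ∀ x ∈ u, v < x)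
    (hu' : u' ≠ []) (hv' : ∀ x ∈ u', v < x) {A B : List ℕ} (hAB : v ∈ A ++ (u ++ B)) :
    SameShape v (leftPart v (A ++ (u ++ B))) (leftPart v (A ++ (u' ++ B))) ∧
      SameShape v (rightPart v (A ++ (u ++ B))) (rightPart v (A ++ (u' ++ B))) := by
  by_cases hA : v ∈ A
  · obtain ⟨A1, A2, rfl, h1⟩ := List.eq_append_cons_of_mem hA
    have e (w : List ℕ) : A1 ++ v :: A2 ++ (w ++ B) = A1 ++ v :: (A2 ++ (w ++ B)) := by simp
    rw [e, e, leftPart_append h1, leftPart_append h1, rightPart_append h1, rightPart_append h1]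
    exact ⟨.refl _ _, sameShape_append hu hv hu' hv' A2 B⟩
  · have hvu : v ∉ u := fun h => lt_irrefl _ (hv v h)
    have hvu' : v ∉ u' := fun h => lt_irrefl _ (hv' v h)
    have hB : v ∈ B := by simpa [hA, hvu] using hAB
    obtain ⟨B1, B2, rfl, h1⟩ := List.eq_append_cons_of_mem hB
    have e (w : List ℕ) : A ++ (w ++ (B1 ++ v :: B2)) = A ++ (w ++ B1) ++ v :: B2 := by simp
    have n1 : v ∉ A ++ (u ++ B1) := by simp [hA, hvu, h1]
    have n2 : v ∉ A ++ (u' ++ B1) := by simp [hA, hvu', h1]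
    rw [e, e, leftPart_append n1, leftPart_append n2, rightPart_append n1, rightPart_append n2]
    exact ⟨sameShape_append hu hv hu' hv' A B1, .refl _ _⟩

/-- Each kind of insertion replaces one gap by a nonempty word in `N` and m + 1, all larger than v.
-/
theorem sameShape_of_mem_insertLetter {N m v : ℕ} {s s' : List ℕ} (hmN : m + 1 < N)
    (hs : IsGapWord N m s) (hs' : s' ∈ insertLetter N (m + 1) s) (h1 : 1 ≤ v) (h2 : v ≤ m) :
    SameShape v (leftPart v s') (leftPart v s) ∧ SameShape v (rightPart v s') (rightPart v s) := by
  obtain ⟨A, B, rfl, h⟩ := mem_insertLetter.1 hs'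
  have hmem : v ∈ A ++ N :: B := List.count_pos_iff.1 (by rw [hs.count_eq v h1 h2]; simp)
  have key (u : List ℕ) (hu : u ≠ []) (hv : ∀ x ∈ u, v < x) :=
    sameShape_parts hu hv (u' := [N]) (by simp) (by simp; omega) (A := A) (B := B)
      (by rcases List.mem_append.1 hmem with h | h
          · simp [h]
          · rcases List.mem_cons.1 h with h | h
            · omega
            · simp [h])
  rcases h with rfl | ⟨-, -, rfl⟩ | ⟨-, rfl⟩
  · simpa using key [m + 1, N] (by simp) (by simp; omega)
  · simpa using key [m + 1] (by simp) (by simp; omega)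
  · simpa using key [N, m + 1, N] (by simp) (by simp; omega)

theorem topIn_congr {v : ℕ} {s s' : List ℕ}
    (h : SameShape v (leftPart v s') (leftPart v s) ∧ SameShape v (rightPart v s') (rightPart v s)) :
    TopIn v s' ↔ TopIn v s := h.2.head

theorem bottomIn_congr {v : ℕ} {s s' : List ℕ}
    (h : SameShape v (leftPart v s') (leftPart v s) ∧ SameShape v (rightPart v s') (rightPart v s)) :
    BottomIn v s' ↔ BottomIn v s := h.1.last

theorem letterWeight_congr {v : ℕ} {s s' : List ℕ} (a b p q t : R)
    (h : SameShape v (leftPart v s') (leftPart v s) ∧ SameShape v (rightPart v s') (rightPart v s)) :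
    letterWeight a b p q t v s' = letterWeight a b p q t v s := by
  simp only [letterWeight, h.1.crossings_eq, h.2.crossings_eq, h.1.forall_lt, h.2.forall_gt,
    topIn_congr h]

theorem gapWeight_congr {N m k : ℕ} {s s' : List ℕ} (a b p q y t : R) (hmk : 2 * m ≤ k)
    (hkN : k + 1 < N) (hs : IsGapWord N k s) (hs' : s' ∈ insertLetter N (k + 1) s) :
    gapWeight a b p q y t m s' = gapWeight a b p q y t m s := by
  have h (v : ℕ) := sameShape_of_mem_insertLetter hkN hs hs' (v := v)
  unfold gapWeight
  congr 1
  · refine prod_congr rfl fun v hv => ?_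
    rw [mem_Icc] at hv
    exact letterWeight_congr _ _ _ _ _ (h v hv.1 (by omega))
  · refine prod_congr rfl fun j hj => ?_
    rw [mem_Icc] at hj
    simp only [dominoWeight, topIn_congr (h (2 * j) (by omega) (by omega)),
      bottomIn_congr (h (2 * j - 1) (by omega) (by omega))]

end Statistics

/-! ### The total weight of the insertions of one letter, then of a pair -/

section Insertion

theorem crossings_append_singleton {v x : ℕ} (hx : v < x) (L : List ℕ) :
    crossings v (L ++ [x]) = crossings v L := by
  induction L with
  | nil => simp [crossings]
  | cons z L ih =>
    rw [List.cons_append, crossings, crossings, ih]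
    cases L with
    | nil => simp [hx.le]
    | cons w L => simp

/-- Only gaps exceed v, and each one but the last is followed by a letter, since two gaps are never
adjacent. -/
theorem crossings_eq_count {N v : ℕ} (hvN : v < N) {L : List ℕ} (hc : (L ++ [N]).IsChain Adj)
    (hL : ∀ x ∈ L, x < v ∨ x = N) : crossings v (L ++ [N]) = L.count N := by
  induction L with
  | nil => simp [crossings]
  | cons x L ih =>
    rw [List.cons_append, List.isChain_cons] at hc
    rw [List.cons_append, crossings, ih hc.2 fun z hz => hL z (by simp [hz]), List.count_cons,
      add_comm]
    congr 1
    rcases hL x (by simp) with hx | rfl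
    · have : x ≠ N := by omega
      simp [this, hx.le]
    · cases L with
      | nil => exact absurd (hc.1 x (by simp)) not_adj_self
      | cons w L =>
        have hw : w < v := by
          rcases hL w (by simp) with h | rfl
          · exact h
          · exact absurd (hc.1 w (by simp)) not_adj_self
        simp [hw, hvN]

namespace IsGapWord

variable {N m : ℕ} {s s' A B : List ℕ}

theorem crossings_left (hmN : m + 1 < N) (hs : IsGapWord N m (A ++ N :: B)) :
    crossings (m + 1) (A ++ [N]) = A.count N := by
  refine crossings_eq_count hmN ?_ fun x hx => ?_
  · have := hs.chain
    rw [show A ++ N :: B = (A ++ [N]) ++ B by simp, List.isChain_append] at this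
    exact this.1
  · rcases hs.mem_bound x (by simp [hx]) with h | h <;> omega

theorem crossings_suffix (hmN : m + 1 < N) (hs : IsGapWord N m (A ++ B)) (hB : B ≠ []) :
    crossings (m + 1) B = B.count N - 1 := by
  obtain ⟨B', rfl⟩ := hs.suffix_last hB
  rw [crossings_eq_count hmN (List.isChain_append.1 hs.chain).2.1 fun x hx => ?_]
  · simp
  · rcases hs.mem_bound x (by simp [hx]) with h | h <;> omega

theorem forall_left_lt (hmN : m + 1 < N) (hs : IsGapWord N m (A ++ N :: B)) :
    (∀ x ∈ A, x < m + 1) ↔ A.count N = 0 := by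
  rw [List.count_eq_zero]
  constructor
  · intro h hN
    have := h N hN
    omega
  · intro h x hx
    rcases hs.mem_bound x (by simp [hx]) with h' | rfl
    · omega
    · exact absurd hx h

theorem count_right_eq_zero (hs : IsGapWord N m (A ++ N :: B)) : B.count N = 0 ↔ B = [] := by
  constructor
  · intro h
    by_contra hB
    obtain ⟨B', rfl⟩ := IsGapWord.suffix_last (A := A ++ [N]) (by simpa using hs) hB
    simp at h
  · rintro rfl; simp

/-- A letter after the gap would be smaller than m + 1, so the gap has to be the final one. -/
theorem forall_right_gt (hN : Even N) (hmN : m + 1 < N) (hs : IsGapWord N m (A ++ N :: B)) :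
    (∀ x ∈ N :: B, m + 1 < x) ↔ B.count N = 0 := by
  rw [hs.count_right_eq_zero]
  constructor
  · intro h
    cases B with
    | nil => rfl
    | cons y B =>
      have := hs.adj_right hN (by omega) (y := y) (by simp)
      have := h y (by simp)
      omega
  · rintro rfl; simpa using hmN

end IsGapWord

variable {R : Type*} [CommRing R]

theorem letterWeight_append (a b p q t : R) {v : ℕ} {A B : List ℕ} (hv : v ∉ A) :
    letterWeight a b p q t v (A ++ v :: B) =
      p ^ crossings v B * q ^ crossings v A *
      if Even v then (if ∀ x ∈ A, x < v then a else 1) *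
        (if TopIn v (A ++ v :: B) then t else 1)
      else if ∀ x ∈ B, v < x then b else 1 := by
  simp only [letterWeight, leftPart_append hv, rightPart_append hv]

theorem topIn_append {v : ℕ} {A B : List ℕ} (hv : v ∉ A) :
    TopIn v (A ++ v :: B) ↔ ∃ y ∈ B.head?, y < v := by
  rw [TopIn, rightPart_append hv]

theorem bottomIn_append {v : ℕ} {A B : List ℕ} (hv : v ∉ A) :
    BottomIn v (A ++ v :: B) ↔ ∃ x ∈ A.getLast?, v < x := by
  rw [BottomIn, leftPart_append hv]

namespace IsGapWord

variable {N m : ℕ} {s s' A B : List ℕ} (a b p q t : R)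

theorem notMem_left (hmN : m + 1 < N) (hs : IsGapWord N m (A ++ N :: B)) : m + 1 ∉ A := fun h =>
  hs.notMem_succ hmN (List.mem_append_left _ h)

theorem notMem_left_gap (hmN : m + 1 < N) (hs : IsGapWord N m (A ++ N :: B)) :
    m + 1 ∉ A ++ [N] := by
  have := hs.notMem_left hmN
  simp [this]
  omega

theorem not_topIn_inner (hmN : m + 1 < N) (hs : IsGapWord N m (A ++ N :: B)) :
    ¬ TopIn (m + 1) (A ++ (m + 1) :: N :: B) := by
  rw [topIn_append (hs.notMem_left hmN)]
  simp
  omega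

theorem topIn_top (hN : Even N) (hmN : m + 1 < N) (hs : IsGapWord N m (A ++ N :: B))
    (hB : B.count N ≠ 0) : TopIn (m + 1) (A ++ (m + 1) :: B) := by
  rw [topIn_append (hs.notMem_left hmN)]
  cases B with
  | nil => simp at hB
  | cons y B =>
    have := hs.adj_right hN (by omega) (y := y) (by simp)
    simp
    omega

theorem not_bottomIn_inner (hN : Even N) (hmN : m + 1 < N) (hs : IsGapWord N m (A ++ N :: B)) :
    ¬ BottomIn (m + 1) (A ++ (m + 1) :: N :: B) := by
  rw [bottomIn_append (hs.notMem_left hmN)]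
  rintro ⟨x, hx, h⟩
  have := hs.adj_left hN hx
  omega

theorem bottomIn_bottom (hmN : m + 1 < N) (hs : IsGapWord N m (A ++ N :: B)) :
    BottomIn (m + 1) (A ++ N :: (m + 1) :: N :: B) := by
  rw [show A ++ N :: (m + 1) :: N :: B = (A ++ [N]) ++ (m + 1) :: N :: B by simp,
    bottomIn_append (hs.notMem_left_gap hmN)]
  simpa using hmN

theorem letterWeight_inner_even (hmN : m + 1 < N) (hs : IsGapWord N m (A ++ N :: B))
    (hm : Even (m + 1)) :
    letterWeight a b p q t (m + 1) (A ++ (m + 1) :: N :: B) =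
      p ^ B.count N * q ^ A.count N * if A.count N = 0 then a else 1 := by
  rw [letterWeight_append _ _ _ _ _ (hs.notMem_left hmN), if_pos hm,
    if_neg (hs.not_topIn_inner hmN),
    hs.crossings_suffix hmN (by simp), ← crossings_append_singleton hmN A, hs.crossings_left hmN]
  simp only [hs.forall_left_lt hmN]
  simp

/-- The exponent of p is one less than for an inner insertion: the gap used is closed, and the final
gap of B is not followed by a letter. -/
theorem letterWeight_top (hN : Even N) (hmN : m + 1 < N) (hs : IsGapWord N m (A ++ N :: B))
    (hm : Even (m + 1)) (hB : B.count N ≠ 0) :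
    letterWeight a b p q t (m + 1) (A ++ (m + 1) :: B) =
      p ^ (B.count N - 1) * q ^ A.count N * (if A.count N = 0 then a else 1) * t := by
  have hB' : B ≠ [] := by rintro rfl; simp at hB
  rw [letterWeight_append _ _ _ _ _ (hs.notMem_left hmN), if_pos hm,
    if_pos (hs.topIn_top hN hmN hB),
    IsGapWord.crossings_suffix (A := A ++ [N]) hmN (by simpa using hs) hB',
    ← crossings_append_singleton hmN A, hs.crossings_left hmN]
  simp only [hs.forall_left_lt hmN, mul_assoc]

theorem letterWeight_inner_odd (hN : Even N) (hmN : m + 1 < N) (hs : IsGapWord N m (A ++ N :: B))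
    (hm : ¬ Even (m + 1)) :
    letterWeight a b p q t (m + 1) (A ++ (m + 1) :: N :: B) =
      p ^ B.count N * q ^ A.count N * if B.count N = 0 then b else 1 := by
  rw [letterWeight_append _ _ _ _ _ (hs.notMem_left hmN), if_neg hm,
    hs.crossings_suffix hmN (by simp), ← crossings_append_singleton hmN A, hs.crossings_left hmN]
  simp only [hs.forall_right_gt hN hmN]
  simp

theorem letterWeight_bottom (hN : Even N) (hmN : m + 1 < N) (hs : IsGapWord N m (A ++ N :: B))
    (hm : ¬ Even (m + 1)) :
    letterWeight a b p q t (m + 1) (A ++ N :: (m + 1) :: N :: B) =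
      p ^ B.count N * q ^ A.count N * if B.count N = 0 then b else 1 := by
  rw [show A ++ N :: (m + 1) :: N :: B = (A ++ [N]) ++ (m + 1) :: N :: B by simp,
    letterWeight_append _ _ _ _ _ (hs.notMem_left_gap hmN), if_neg hm,
    hs.crossings_suffix hmN (by simp), hs.crossings_left hmN]
  simp only [hs.forall_right_gt hN hmN]
  simp

end IsGapWord

theorem sum_range_eq_pqInt (x p q : R) (h : ℕ) :
    ∑ i ∈ range (h + 1), p ^ (h - i) * q ^ i * (if i = 0 then x else 1) = pqInt x (h + 1) p q := by
  rw [sum_range_succ', pqInt, add_comm, Nat.add_sub_cancel]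
  congr 1
  · simp [mul_comm]
  · rw [show Icc 1 h = Ico 1 (h + 1) from rfl, sum_Ico_eq_sum_range, Nat.add_sub_cancel]
    refine sum_congr rfl fun i _ => ?_
    rw [if_neg (by omega), mul_one, Nat.add_comm i 1]

/-- For odd letters the extra variable marks the rightmost gap instead of the leftmost one;
reversing the sum exchanges p and q. -/
theorem sum_range_eq_pqInt' (x p q : R) (h : ℕ) :
    ∑ i ∈ range (h + 1), p ^ (h - i) * q ^ i * (if h - i = 0 then x else 1) =
      pqInt x (h + 1) q p := by
  rw [← sum_range_eq_pqInt, ← sum_range_reflect]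
  refine sum_congr rfl fun i hi => ?_
  have : h - (h - i) = i := by have := mem_range.1 hi; omega
  rw [Nat.add_sub_cancel, this, mul_comm (p ^ i)]

theorem sum_map_flatMap {α β : Type*} (l : List α) (f : α → List β) (g : β → R) :
    ((l.flatMap f).map g).sum = (l.map fun x => ((f x).map g).sum).sum := by
  induction l with
  | nil => simp
  | cons x l ih => simp [ih]

theorem sum_map_filter {α : Type*} (l : List α) (P : α → Bool) (g : α → R) :
    ((l.filter P).map g).sum = (l.map fun x => if P x then g x else 0).sum := by
  induction l with
  | nil => simp
  | cons x l ih => by_cases hx : P x <;> simp [hx, ih]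

namespace IsGapWord

variable {N m : ℕ} {s s' : List ℕ} (a b p q y t : R)

theorem count_pos (hs : IsGapWord N m s) : 0 < s.count N := by
  obtain ⟨s', rfl⟩ := hs.last
  simp

theorem sum_insertInner_odd (hN : Even N) (hmN : m + 1 < N) (hs : IsGapWord N m s)
    (hm : ¬ Even (m + 1)) :
    ((insertInner N (m + 1) s).map (letterWeight a b p q t (m + 1))).sum =
      pqInt b (s.count N) q p := by
  have h : ((insertInner N (m + 1) s).map (letterWeight a b p q t (m + 1))).sum =
      ((splits N s).map fun P => (fun i j => p ^ j * q ^ i * if j = 0 then b else 1)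
        (P.1.count N) (P.2.count N)).sum := by
    rw [insertInner, List.map_map]
    refine congrArg List.sum (List.map_congr_left fun P hP => ?_)
    have hP' : IsGapWord N m (P.1 ++ N :: P.2) := by rwa [mem_splits.1 hP]
    exact hP'.letterWeight_inner_odd a b p q t hN hmN hm
  have hc := hs.count_pos
  rw [h, sum_splits N s fun i j => p ^ j * q ^ i * if j = 0 then b else 1]
  obtain ⟨c, hc⟩ : ∃ c, s.count N = c + 1 := ⟨s.count N - 1, by omega⟩
  rw [hc, ← sum_range_eq_pqInt', Nat.add_sub_cancel]

theorem sum_insertBottom (hN : Even N) (hmN : m + 1 < N) (hs : IsGapWord N m s)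
    (hm : ¬ Even (m + 1)) :
    ((insertBottom N (m + 1) s).map (letterWeight a b p q t (m + 1))).sum =
      pqInt b (s.count N) q p := by
  rw [← hs.sum_insertInner_odd a b p q t hN hmN hm, insertInner, insertBottom, List.map_map,
    List.map_map]
  refine congrArg List.sum (List.map_congr_left fun P hP => ?_)
  have hP' : IsGapWord N m (P.1 ++ N :: P.2) := by rwa [mem_splits.1 hP]
  simp only [Function.comp_apply]
  rw [hP'.letterWeight_inner_odd a b p q t hN hmN hm, hP'.letterWeight_bottom a b p q t hN hmN hm]

theorem sum_insertInner_even (hmN : m + 1 < N) (hs : IsGapWord N m s) (hm : Even (m + 1)) :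
    ((insertInner N (m + 1) s).map (letterWeight a b p q t (m + 1))).sum =
      pqInt a (s.count N) p q := by
  have h : ((insertInner N (m + 1) s).map (letterWeight a b p q t (m + 1))).sum =
      ((splits N s).map fun P => (fun i j => p ^ j * q ^ i * if i = 0 then a else 1)
        (P.1.count N) (P.2.count N)).sum := by
    rw [insertInner, List.map_map]
    refine congrArg List.sum (List.map_congr_left fun P hP => ?_)
    have hP' : IsGapWord N m (P.1 ++ N :: P.2) := by rwa [mem_splits.1 hP]
    exact hP'.letterWeight_inner_even a b p q t hmN hm
  have hc := hs.count_pos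
  rw [h, sum_splits N s fun i j => p ^ j * q ^ i * if i = 0 then a else 1]
  obtain ⟨c, hc⟩ : ∃ c, s.count N = c + 1 := ⟨s.count N - 1, by omega⟩
  rw [hc, ← sum_range_eq_pqInt, Nat.add_sub_cancel]

theorem sum_insertTop (hN : Even N) (hmN : m + 1 < N) (hs : IsGapWord N m s)
    (hm : Even (m + 1)) :
    ((insertTop N (m + 1) s).map (letterWeight a b p q t (m + 1))).sum =
      if s.count N = 1 then 0 else t * pqInt a (s.count N - 1) p q := by
  have h : ((insertTop N (m + 1) s).map (letterWeight a b p q t (m + 1))).sum =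
      ((splits N s).map fun P => (fun i j => if j ≠ 0 then
        p ^ (j - 1) * q ^ i * (if i = 0 then a else 1) * t else 0)
        (P.1.count N) (P.2.count N)).sum := by
    rw [insertTop, List.map_map, sum_map_filter]
    refine congrArg List.sum (List.map_congr_left fun P hP => ?_)
    have hP' : IsGapWord N m (P.1 ++ N :: P.2) := by rwa [mem_splits.1 hP]
    by_cases h0 : P.2.count N = 0
    · simp [h0]
    · simpa [h0] using hP'.letterWeight_top a b p q t hN hmN hm h0
  have hc := hs.count_pos
  rw [h, sum_splits N s fun i j => if j ≠ 0 then
    p ^ (j - 1) * q ^ i * (if i = 0 then a else 1) * t else 0]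
  obtain ⟨c, hc⟩ : ∃ c, s.count N = c + 1 := ⟨s.count N - 1, by omega⟩
  rw [hc, sum_range_succ, Nat.add_sub_cancel]
  -- A single gap is the final one and cannot be closed. The case is separated because `pqInt a 0 p
  -- q` is a, not 0.
  cases c with
  | zero => simp
  | succ c =>
    rw [if_neg (by simp), add_zero, if_neg (by omega),
      ← sum_range_eq_pqInt, mul_sum]
    refine sum_congr rfl fun i hi => ?_
    have := mem_range.1 hi
    rw [if_pos (by omega), show c + 1 - i - 1 = c - i by omega]
    ring

theorem gapWeight_of_mem_insertLetter {r : List ℕ} (hN : Even N) (hmN : 2 * m + 2 < N)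
    (hs : IsGapWord N (2 * m) s)
    (hs' : s' ∈ insertLetter N (2 * m + 1) s) (hr : r ∈ insertLetter N (2 * m + 2) s') :
    gapWeight a b p q y t (m + 1) r = gapWeight a b p q y t m s *
      letterWeight a b p q t (2 * m + 1) s' *
      (letterWeight a b p q t (2 * m + 2) r *
        if TopIn (2 * m + 2) r ∧ BottomIn (2 * m + 1) s' then y else 1) := by
  have hsg' := hs.of_mem_insertLetter hN (by omega) hs'
  have hsame := sameShape_of_mem_insertLetter (v := 2 * m + 1) hmN hsg' hr (by omega) le_rfl
  rw [← gapWeight_congr (m := m) a b p q y t le_rfl (by omega) hs hs',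
    ← gapWeight_congr (m := m) a b p q y t (by omega) hmN hsg' hr,
    ← letterWeight_congr a b p q t hsame, gapWeight, gapWeight, mul_add,
    prod_Icc_succ_top (by omega), prod_Icc_succ_top (by omega), prod_Icc_succ_top (by omega)]
  simp only [dominoWeight, mul_add, mul_one, show 2 * m + 2 - 1 = 2 * m + 1 by rfl,
    bottomIn_congr hsame]
  ring

/-- `P` will say that the preceding odd letter is a descent bottom, and `G` will be the weight of
the rest of the path from the new height. -/
theorem sum_insertLetter_even (hN : Even N) (hmN : m + 1 < N) (hs : IsGapWord N m s)
    (hm : Even (m + 1)) (P : Prop) [Decidable P] (G : ℕ → R) :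
    ((insertLetter N (m + 1) s).map fun r => letterWeight a b p q t (m + 1) r *
      (if TopIn (m + 1) r ∧ P then y else 1) * G (r.count N)).sum =
    pqInt a (s.count N) p q * G (s.count N) +
      (if s.count N = 1 then 0 else t * pqInt a (s.count N - 1) p q) * (if P then y else 1) *
        G (s.count N - 1) := by
  rw [insertLetter, if_pos hm, List.map_append, List.sum_append,
    ← hs.sum_insertInner_even a b p q t hmN hm, ← hs.sum_insertTop a b p q t hN hmN hm,
    ← List.sum_map_mul_right, mul_assoc, ← List.sum_map_mul_right]
  congr 1 <;> refine congrArg List.sum (List.map_congr_left fun r hr => ?_)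
  · obtain ⟨P, hP, rfl⟩ := List.mem_map.1 hr
    rw [mem_splits] at hP
    subst hP
    have : m + 1 ≠ N := by omega
    simp [hs.not_topIn_inner hmN, this]
  · obtain ⟨P, hP, rfl⟩ := List.mem_map.1 hr
    rw [List.mem_filter, mem_splits, decide_eq_true_eq] at hP
    obtain ⟨hP, h0⟩ := hP
    subst hP
    have : m + 1 ≠ N := by omega
    have hc : (P.1 ++ (m + 1) :: P.2).count N = (P.1 ++ N :: P.2).count N - 1 := by
      simp [this]
    simp [hs.topIn_top hN hmN h0, hc, mul_assoc]

theorem sum_insertLetter_odd (hN : Even N) (hmN : m + 1 < N) (hs : IsGapWord N m s)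
    (hm : ¬ Even (m + 1)) (G : Bool → ℕ → R) :
    ((insertLetter N (m + 1) s).map fun r => letterWeight a b p q t (m + 1) r *
      G (decide (BottomIn (m + 1) r)) (r.count N)).sum =
    pqInt b (s.count N) q p * (G false (s.count N) + G true (s.count N + 1)) := by
  rw [insertLetter, if_neg hm, List.map_append, List.sum_append, mul_add]
  nth_rw 1 [← hs.sum_insertInner_odd a b p q t hN hmN hm]
  rw [← hs.sum_insertBottom a b p q t hN hmN hm, ← List.sum_map_mul_right,
    ← List.sum_map_mul_right]
  congr 1 <;> refine congrArg List.sum (List.map_congr_left fun r hr => ?_)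
  · obtain ⟨P, hP, rfl⟩ := List.mem_map.1 hr
    rw [mem_splits] at hP
    subst hP
    have : m + 1 ≠ N := by omega
    simp [hs.not_bottomIn_inner hN hmN, this]
  · obtain ⟨P, hP, rfl⟩ := List.mem_map.1 hr
    rw [mem_splits] at hP
    subst hP
    have : m + 1 ≠ N := by omega
    simp [hs.bottomIn_bottom hmN, this, add_assoc]

/-- This is one step of the Motzkin path. Inner–inner and bottom–top both keep the number of gaps,
with sums differing by the factor ty; bottom–inner goes up and inner–top goes down. -/
theorem sum_insertLetter_insertLetter (hN : Even N) (hmN : 2 * m + 2 < N)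
    (hs : IsGapWord N (2 * m) s) (G : ℕ → R) :
    ((insertLetter N (2 * m + 1) s).map fun s' => ((insertLetter N (2 * m + 2) s').map fun r =>
      gapWeight a b p q y t (m + 1) r * G (r.count N)).sum).sum =
    gapWeight a b p q y t m s * (pqInt b (s.count N) q p *
      ((1 + t * y) * pqInt a (s.count N) p q * G (s.count N) +
        pqInt a (s.count N + 1) p q * G (s.count N + 1) +
        if s.count N = 1 then 0 else t * pqInt a (s.count N - 1) p q * G (s.count N - 1))) := by
  set H : Bool → ℕ → R := fun P c => pqInt a c p q * G c +
    (if c = 1 then 0 else t * pqInt a (c - 1) p q) * (if P then y else 1) * G (c - 1) with hH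
  have h : ∀ s' ∈ insertLetter N (2 * m + 1) s, ((insertLetter N (2 * m + 2) s').map fun r =>
      gapWeight a b p q y t (m + 1) r * G (r.count N)).sum = gapWeight a b p q y t m s *
        (letterWeight a b p q t (2 * m + 1) s' * H (decide (BottomIn (2 * m + 1) s')) (s'.count N)) := by
    intro s' hs'
    have hsg' := hs.of_mem_insertLetter hN (by omega) hs'
    simp only [hH, ← mul_assoc, decide_eq_true_eq]
    have := hsg'.sum_insertLetter_even a b p q y t hN hmN (by simp [parity_simps])
      (BottomIn (2 * m + 1) s') G
    convert! congrArg (gapWeight a b p q y t m s * letterWeight a b p q t (2 * m + 1) s' * ·) this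
      using 1
    rw [← List.sum_map_mul_left]
    refine congrArg List.sum (List.map_congr_left fun r hr => ?_)
    rw [hs.gapWeight_of_mem_insertLetter a b p q y t hN hmN hs' hr]
    ring
  rw [List.map_congr_left h, List.sum_map_mul_left,
    hs.sum_insertLetter_odd a b p q t hN (by omega) (by simp [parity_simps])]
  have hc := hs.count_pos
  congr 2
  simp only [hH, if_true, Bool.false_eq_true, if_false, Nat.add_sub_cancel, if_neg (show s.count N + 1 ≠ 1 by omega)]
  split_ifs <;> ring

end IsGapWord

end Insertion

/-! ### From permutations to gap words with a single gap -/

section Bridge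

/-- `o` and `o'` hold letters `x`, `y` with `x > v > y`. -/
def CrossAt (v : ℕ) (o o' : Option ℕ) : Prop := (∃ x ∈ o, v < x) ∧ ∃ y ∈ o', y < v

instance (v : ℕ) (o o' : Option ℕ) : Decidable (CrossAt v o o') := by
  unfold CrossAt; infer_instance

theorem crossings_eq_sum (v : ℕ) (L : List ℕ) {M : ℕ} (hM : L.length ≤ M) :
    crossings v L = ∑ j ∈ range M,
      if CrossAt v L[j]? L[j + 1]? then 1 else 0 := by
  induction L generalizing M with
  | nil => simp [crossings, CrossAt]
  | cons x L ih =>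
    obtain ⟨M, rfl⟩ : ∃ M', M = M' + 1 := ⟨M - 1, by simp at hM; omega⟩
    rw [sum_range_succ', crossings, ih (by simpa using hM), add_comm]
    simp [List.head?_eq_getElem?, CrossAt]

/-- Used for consecutive positions: descents may be counted by their tops, and the pairs in `les` by
the position before i. -/
theorem card_filter_exists_comm {m : ℕ} (Q : Fin m → Fin m → Prop)
    [∀ x y, Decidable (Q x y)] (h1 : ∀ x y y', Q x y → Q x y' → y = y')
    (h2 : ∀ x x' y, Q x y → Q x' y → x = x') :
    #{z : Fin m × Fin m | Q z.1 z.2} = #{x | ∃ y, Q x y} ∧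
      #{z : Fin m × Fin m | Q z.1 z.2} = #{y | ∃ x, Q x y} := by
  constructor
  · rw [← card_image_of_injOn (f := Prod.fst)]
    · congr 1; ext x; simp
    · rintro ⟨x, y⟩ h ⟨x', y'⟩ h' (rfl : x = x')
      simp only [coe_filter, Set.mem_ofPred_eq, mem_univ, true_and] at h h'
      rw [h1 x y y' h h']
  · rw [← card_image_of_injOn (f := Prod.snd)]
    · congr 1; ext x; simp
    · rintro ⟨x, y⟩ h ⟨x', y'⟩ h' (rfl : y = y')
      simp only [coe_filter, Set.mem_ofPred_eq, mem_univ, true_and] at h h'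
      rw [h2 x x' y h h']

variable {m : ℕ}

/-- The word of `σ`, as a list. -/
def word (σ : Equiv.Perm (Fin m)) : List ℕ := List.ofFn (letter σ)

theorem length_word (σ : Equiv.Perm (Fin m)) : (word σ).length = m := by simp [word]

theorem exists_getElem?_word (σ : Equiv.Perm (Fin m)) (j : ℕ) (P : ℕ → Prop) :
    (∃ x ∈ (word σ)[j]?, P x) ↔ ∃ i : Fin m, (i : ℕ) = j ∧ P (letter σ i) := by
  by_cases hj : j < m
  · have : (word σ)[j]? = some (letter σ ⟨j, hj⟩) := by simp [word, hj]
    simp only [this, Option.mem_def, Option.some.injEq, exists_eq_left']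
    exact ⟨fun h => ⟨_, rfl, h⟩, by rintro ⟨i, rfl, h⟩; exact h⟩
  · have : (word σ)[j]? = none := by simp [word, hj]
    simp only [this, Option.mem_def, reduceCtorEq, false_and, exists_false, false_iff]
    rintro ⟨i, rfl, -⟩
    exact hj i.2

theorem crossAt_word (σ : Equiv.Perm (Fin m)) (v : ℕ) (j : Fin m) :
    CrossAt v (word σ)[(j : ℕ)]? (word σ)[(j : ℕ) + 1]? ↔
      v < letter σ j ∧ ∃ h : Fin m, (j : ℕ) + 1 = h ∧ letter σ h < v := by
  rw [CrossAt, exists_getElem?_word σ _ (v < ·), exists_getElem?_word σ _ (· < v)]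
  simp [Fin.val_inj, eq_comm]

theorem letter_inj (σ : Equiv.Perm (Fin m)) {i j : Fin m} : letter σ i = letter σ j ↔ i = j := by
  simp [letter, Fin.val_inj]

theorem word_eq (σ : Equiv.Perm (Fin m)) (i : Fin m) :
    word σ = (word σ).take i ++ letter σ i :: (word σ).drop (i + 1) := by
  have h : (i : ℕ) < (word σ).length := by simp [length_word]
  have e : (word σ)[(i : ℕ)] = letter σ i := by simp [word]
  rw [← e, ← List.drop_eq_getElem_cons h, List.take_append_drop]

theorem mem_take_word (σ : Equiv.Perm (Fin m)) (i : ℕ) (x : ℕ) :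
    x ∈ (word σ).take i ↔ ∃ j : Fin m, (j : ℕ) < i ∧ letter σ j = x := by
  rw [List.mem_iff_getElem?]
  constructor
  · rintro ⟨k, hk⟩
    rw [List.getElem?_take] at hk
    split_ifs at hk with h
    obtain ⟨j, rfl, hj⟩ := (exists_getElem?_word σ k (· = x)).1 ⟨x, hk, rfl⟩
    exact ⟨j, h, hj⟩
  · rintro ⟨j, hj, rfl⟩
    refine ⟨j, ?_⟩
    rw [List.getElem?_take, if_pos hj]
    simp [word]

theorem mem_drop_word (σ : Equiv.Perm (Fin m)) (i : ℕ) (x : ℕ) :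
    x ∈ (word σ).drop i ↔ ∃ j : Fin m, i ≤ (j : ℕ) ∧ letter σ j = x := by
  rw [List.mem_iff_getElem?]
  constructor
  · rintro ⟨k, hk⟩
    rw [List.getElem?_drop] at hk
    obtain ⟨j, hjk, hj⟩ := (exists_getElem?_word σ _ (· = x)).1 ⟨x, hk, rfl⟩
    exact ⟨j, by omega, hj⟩
  · rintro ⟨j, hj, rfl⟩
    refine ⟨j - i, ?_⟩
    rw [List.getElem?_drop, show i + (j - i) = (j : ℕ) by omega]
    simp [word]

theorem letter_notMem_take (σ : Equiv.Perm (Fin m)) (i : Fin m) :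
    letter σ i ∉ (word σ).take i := by
  rw [mem_take_word]
  rintro ⟨j, hj, h⟩
  rw [letter_inj] at h
  subst h
  exact lt_irrefl _ hj

theorem leftPart_word (σ : Equiv.Perm (Fin m)) (N : ℕ) (i : Fin m) :
    leftPart (letter σ i) (word σ ++ [N]) = (word σ).take i := by
  conv_lhs => rw [word_eq σ i, List.append_assoc, List.cons_append]
  exact leftPart_append (letter_notMem_take σ i)

theorem rightPart_word (σ : Equiv.Perm (Fin m)) (N : ℕ) (i : Fin m) :
    rightPart (letter σ i) (word σ ++ [N]) = (word σ).drop (i + 1) ++ [N] := by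
  conv_lhs => rw [word_eq σ i, List.append_assoc, List.cons_append]
  exact rightPart_append (letter_notMem_take σ i)

theorem letter_le (σ : Equiv.Perm (Fin m)) (i : Fin m) : letter σ i ≤ m := (σ i).2

theorem topIn_word (σ : Equiv.Perm (Fin m)) {N : ℕ} (hN : m < N) (i : Fin m) :
    TopIn (letter σ i) (word σ ++ [N]) ↔ ∃ j, IsDescent σ i j := by
  have hi := letter_le σ i
  rw [TopIn, rightPart_word, List.head?_append, List.head?_eq_getElem?, List.getElem?_drop,
    add_zero]
  have h := exists_getElem?_word σ (i + 1) (· < letter σ i)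
  have h2 : (∃ j, IsDescent σ i j) ↔ ∃ y ∈ (word σ)[(i : ℕ) + 1]?, y < letter σ i := by
    rw [h]
    exact exists_congr fun j => and_congr eq_comm Iff.rfl
  rw [h2]
  cases (word σ)[(i : ℕ) + 1]? with
  | none => simp; omega
  | some x => simp

theorem bottomIn_word (σ : Equiv.Perm (Fin m)) (N : ℕ) (i : Fin m) :
    BottomIn (letter σ i) (word σ ++ [N]) ↔ ∃ j, IsDescent σ j i := by
  rw [BottomIn, leftPart_word, List.getLast?_eq_getElem?, List.length_take, length_word,
    min_eq_left i.2.le, List.getElem?_take]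
  rcases Nat.eq_zero_or_pos (i : ℕ) with h | h
  · rw [h]
    simp only [IsDescent]
    simp [h]
  · rw [if_pos (by omega), exists_getElem?_word]
    exact exists_congr fun j => and_congr (by omega) Iff.rfl

theorem forall_leftPart_word (σ : Equiv.Perm (Fin m)) (N : ℕ) (i : Fin m) :
    (∀ x ∈ leftPart (letter σ i) (word σ ++ [N]), x < letter σ i) ↔ IsLRMax σ i := by
  simp only [leftPart_word, mem_take_word, IsLRMax]
  constructor
  · exact fun h j hj => h _ ⟨j, hj, rfl⟩
  · rintro h _ ⟨j, hj, rfl⟩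
    exact h j hj

theorem forall_rightPart_word (σ : Equiv.Perm (Fin m)) {N : ℕ} (hN : m < N) (i : Fin m) :
    (∀ x ∈ rightPart (letter σ i) (word σ ++ [N]), letter σ i < x) ↔ IsRLMin σ i := by
  simp only [rightPart_word, List.mem_append, mem_drop_word, IsRLMin, List.mem_singleton]
  constructor
  · exact fun h j hj => h _ (Or.inl ⟨j, hj, rfl⟩)
  · rintro h _ (⟨j, hj, rfl⟩ | rfl)
    · exact h j hj
    · exact (letter_le σ i).trans_lt hN

theorem res_eq_sum (σ : Equiv.Perm (Fin m)) {N : ℕ} (hN : m < N) :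
    res σ = ∑ i, crossings (letter σ i) (rightPart (letter σ i) (word σ ++ [N])) := by
  rw [res, card_filter, Fintype.sum_prod_type]
  refine sum_congr rfl fun i _ => ?_
  rw [rightPart_word, crossings_append_singleton ((letter_le σ i).trans_lt hN),
    crossings_eq_sum _ _ (M := m - (i + 1)) (by simp [length_word])]
  simp only [List.getElem?_drop, ← add_assoc]
  rw [← sum_Ico_eq_sum_range (fun j => if CrossAt (letter σ i) (word σ)[j]? (word σ)[j + 1]?
    -- The positions of the right part are shifted back to positions in the whole word.
    then 1 else 0) (i + 1) m, show Ico ((i : ℕ) + 1) m = {j ∈ range m | (i : ℕ) + 1 ≤ j} by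
      ext; simp [and_comm], sum_filter, Finset.sum_range]
  refine sum_congr rfl fun j _ => ?_
  rw [← ite_and]
  refine if_congr (and_congr Iff.rfl ?_) rfl rfl
  rw [crossAt_word]
  constructor
  · rintro ⟨h, h1, h2, h3⟩
    exact ⟨h2, h, h1, h3⟩
  · rintro ⟨h2, h, h1, h3⟩
    exact ⟨h, h1, h2, h3⟩

theorem les_eq_sum (σ : Equiv.Perm (Fin m)) (N : ℕ) :
    les σ = ∑ j, crossings (letter σ j) (leftPart (letter σ j) (word σ ++ [N])) := by
  rw [les, card_filter, Fintype.sum_prod_type_right]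
  refine sum_congr rfl fun j _ => ?_
  rw [leftPart_word, crossings_eq_sum _ _ (M := m) (by simp [length_word]), Finset.sum_range]
  simp only [List.getElem?_take]
  have hQ := card_filter_exists_comm (fun h i : Fin m => (h : ℕ) + 1 = i ∧ i < j ∧
    letter σ j < letter σ h ∧ letter σ i < letter σ j)
    (fun x y y' h h' => by ext; omega) (fun x x' y h h' => by ext; omega)
  have e1 : (∑ i : Fin m, if i < j ∧ ∃ h : Fin m, (h : ℕ) + 1 = i ∧ letter σ j < letter σ h ∧
      letter σ i < letter σ j then 1 else 0) = #{i : Fin m | ∃ h : Fin m, (h : ℕ) + 1 = i ∧ i < j ∧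
      letter σ j < letter σ h ∧ letter σ i < letter σ j} := by
    rw [card_filter]
    refine sum_congr rfl fun i _ => if_congr ?_ rfl rfl
    constructor
    · rintro ⟨h1, h, h2, h3⟩; exact ⟨h, h2, h1, h3⟩
    · rintro ⟨h, h2, h1, h3⟩; exact ⟨h1, h, h2, h3⟩
  -- Crossings are indexed by the larger letter of the adjacent pair, `les` by the smaller one.
  rw [e1, ← hQ.2, hQ.1, card_filter]
  refine sum_congr rfl fun h _ => if_congr ?_ rfl rfl
  by_cases hj : (h : ℕ) + 1 < j
  · rw [if_pos (by omega), if_pos hj, crossAt_word]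
    constructor
    · rintro ⟨i, h1, h2, h3, h4⟩; exact ⟨h3, i, h1, h4⟩
    · rintro ⟨h3, i, h1, h4⟩; exact ⟨i, h1, by omega, h3, h4⟩
  · rw [if_neg hj]
    constructor
    · rintro ⟨i, h1, h2, -⟩; omega
    · rintro ⟨-, y, hy, -⟩; simp at hy

theorem des_eq_card (σ : Equiv.Perm (Fin m)) : des σ = #{i | ∃ j, IsDescent σ i j} :=
  (card_filter_exists_comm (fun i j => IsDescent σ i j)
    (fun x y y' h h' => by have := h.1; have := h'.1; ext; omega)
    (fun x x' y h h' => by have := h.1; have := h'.1; ext; omega)).1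

theorem exists_letter_eq (σ : Equiv.Perm (Fin m)) {v : ℕ} (h1 : 1 ≤ v) (h2 : v ≤ m) :
    ∃ i, letter σ i = v := by
  refine ⟨σ.symm ⟨v - 1, by omega⟩, ?_⟩
  simp [letter]
  omega

theorem topIn_word_iff (σ : Equiv.Perm (Fin m)) {N v : ℕ} (hN : m < N) (h1 : 1 ≤ v) (h2 : v ≤ m) :
    TopIn v (word σ ++ [N]) ↔ IsDescentTop σ v := by
  obtain ⟨i, rfl⟩ := exists_letter_eq σ h1 h2
  rw [topIn_word σ hN]
  constructor
  · rintro ⟨j, h⟩; exact ⟨i, j, h, rfl⟩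
  · rintro ⟨i', j, h, e⟩
    rw [letter_inj] at e
    subst e
    exact ⟨j, h⟩

theorem bottomIn_word_iff (σ : Equiv.Perm (Fin m)) {v : ℕ} (N : ℕ) (h1 : 1 ≤ v) (h2 : v ≤ m) :
    BottomIn v (word σ ++ [N]) ↔ IsDescentBottom σ v := by
  obtain ⟨i, rfl⟩ := exists_letter_eq σ h1 h2
  rw [bottomIn_word σ]
  constructor
  · rintro ⟨j, h⟩; exact ⟨j, i, h, rfl⟩
  · rintro ⟨j, i', h, e⟩
    rw [letter_inj] at e
    subst e
    exact ⟨j, h⟩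

theorem prod_Icc_eq_prod_letter {M : Type*} [CommMonoid M] (σ : Equiv.Perm (Fin m)) (f : ℕ → M) :
    ∏ v ∈ Icc 1 m, f v = ∏ i, f (letter σ i) := by
  unfold letter
  rw [Equiv.prod_comp σ fun i : Fin m => f (i + 1), ← Finset.prod_range fun i => f (i + 1),
    show Icc 1 m = Ico 1 (m + 1) from rfl, prod_Ico_eq_prod_range]
  simp [add_comm]

theorem mem_evenOddPerms {n : ℕ} {σ : Equiv.Perm (Fin (2 * n))} : σ ∈ evenOddPerms n ↔
    ∀ i j, IsDescent σ i j → Even (letter σ i) ∧ Odd (letter σ j) := by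
  simp [evenOddPerms]

theorem gapWeight_word {R : Type*} [CommRing R] (a b p q y t : R) {n N : ℕ} (hN : 2 * n < N)
    {σ : Equiv.Perm (Fin (2 * n))} (hσ : σ ∈ evenOddPerms n) :
    gapWeight a b p q y t n (word σ ++ [N]) = a ^ lema σ * 1 ^ loma σ * b ^ romi σ * 1 ^ remi σ *
      p ^ res σ * q ^ les σ * y ^ dom σ * t ^ des σ := by
  have hσ' := mem_evenOddPerms.1 hσ
  have hw (i : Fin (2 * n)) : letterWeight a b p q t (letter σ i) (word σ ++ [N]) =
      p ^ crossings (letter σ i) (rightPart (letter σ i) (word σ ++ [N])) *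
      q ^ crossings (letter σ i) (leftPart (letter σ i) (word σ ++ [N])) *
      (if IsLRMax σ i ∧ Even (letter σ i) then a else 1) *
      (if ∃ j, IsDescent σ i j then t else 1) *
      (if IsRLMin σ i ∧ Odd (letter σ i) then b else 1) := by
    simp only [letterWeight, forall_leftPart_word, forall_rightPart_word σ hN, topIn_word σ hN,
      ← Nat.not_even_iff_odd]
    by_cases he : Even (letter σ i)
    · simp [he, mul_assoc]
    -- `letterWeight` gives t to even tops only; no descent is missed, because every top is even.
    · have : ¬ ∃ j, IsDescent σ i j := fun ⟨j, h⟩ => he (hσ' i j h).1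
      simp [he, this]
  have hd : ∏ j ∈ Icc 1 n, dominoWeight y j (word σ ++ [N]) = y ^ dom σ := by
    rw [dom, ← prod_const, prod_filter]
    refine prod_congr rfl fun j hj => ?_
    rw [mem_Icc] at hj
    simp only [dominoWeight, topIn_word_iff σ hN (v := 2 * j) (by omega) (by omega),
      bottomIn_word_iff σ N (v := 2 * j - 1) (by omega) (by omega)]
  rw [gapWeight, hd, prod_Icc_eq_prod_letter σ, prod_congr rfl fun i _ => hw i]
  simp only [prod_mul_distrib, prod_pow_eq_pow_sum, ← res_eq_sum σ hN, ← les_eq_sum,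
    ← prod_filter, prod_const, one_pow, des_eq_card, lema, romi]
  ring

theorem word_injective : Function.Injective (word : Equiv.Perm (Fin m) → List ℕ) := by
  intro σ τ h
  have := List.ofFn_injective h
  ext i
  simpa [letter] using congrFun this i

theorem isGapWord_word {n N : ℕ} (hN : 2 * n < N) (σ : Equiv.Perm (Fin (2 * n))) :
    IsGapWord N (2 * n) (word σ ++ [N]) ↔ σ ∈ evenOddPerms n := by
  have hchain : (word σ ++ [N]).IsChain Adj ↔ σ ∈ evenOddPerms n := by
    have hlast : ∀ x ∈ (word σ).getLast?, Adj x N := fun x hx => by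
      obtain ⟨i, rfl⟩ := (List.mem_ofFn' _ _).1 (List.mem_of_mem_getLast? hx)
      exact Or.inl ((letter_le σ i).trans_lt hN)
    rw [List.isChain_append, List.isChain_iff_getElem, mem_evenOddPerms]
    constructor
    · rintro ⟨h, -⟩ i j ⟨h1, h2⟩
      have := h i (by rw [length_word]; omega)
      simp only [word, List.getElem_ofFn, h1] at this
      exact this.resolve_left h2.not_gt
    · intro h
      refine ⟨fun i hi => ?_, by simp, by simpa using hlast⟩
      rw [length_word] at hi
      simp only [word, List.getElem_ofFn]
      by_cases hlt : letter σ ⟨i, by omega⟩ < letter σ ⟨i + 1, hi⟩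
      · exact Or.inl hlt
      · have hne : letter σ ⟨i + 1, hi⟩ ≠ letter σ ⟨i, by omega⟩ := by
          rw [Ne, letter_inj]; simp
        exact Or.inr (h _ _ ⟨rfl, by omega⟩)
  refine ⟨fun h => hchain.1 h.chain, fun h => ⟨hchain.2 h, fun v h1 h2 => ?_, fun x hx => ?_,
    word σ, rfl⟩⟩
  · obtain ⟨i, rfl⟩ := exists_letter_eq σ h1 h2
    have hnd : (word σ).Nodup := List.nodup_ofFn.2 fun i j h => (letter_inj σ).1 h
    have hi : letter σ i ∈ word σ := (List.mem_ofFn' _ _).2 ⟨i, rfl⟩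
    have : N ≠ letter σ i := by omega
    simp [List.count_eq_one_of_mem hnd hi, this]
  · rcases List.mem_append.1 hx with h | h
    · obtain ⟨i, rfl⟩ := (List.mem_ofFn' _ _).1 h
      exact Or.inl ⟨by simp [letter], letter_le σ i⟩
    · exact Or.inr (by simpa using h)

/-- The only gap is the final one, so the rest lists 1, …, m once each. -/
theorem IsGapWord.exists_word {N : ℕ} {s : List ℕ} (hN : m < N) (hs : IsGapWord N m s)
    (hc : s.count N = 1) : ∃ σ : Equiv.Perm (Fin m), s = word σ ++ [N] := by
  obtain ⟨L, rfl⟩ := hs.last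
  have hNL : N ∉ L := by simpa [List.count_eq_zero] using hc
  have hb : ∀ x ∈ L, 1 ≤ x ∧ x ≤ m := fun x hx =>
    (hs.mem_bound x (by simp [hx])).resolve_right fun h => hNL (h ▸ hx)
  have hcount : ∀ v, 1 ≤ v → v ≤ m → L.count v = 1 := fun v h1 h2 => by
    have : N ≠ v := by omega
    simpa [List.count_cons, this] using hs.count_eq v h1 h2
  have hnd : L.Nodup := List.nodup_iff_count_le_one.2 fun v => by
    by_cases hv : v ∈ L
    · rw [hcount v (hb v hv).1 (hb v hv).2]
    · simp [List.count_eq_zero.2 hv]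
  have hlen : L.length = m := by
    rw [← List.toFinset_card_of_nodup hnd, show L.toFinset = Icc 1 m from ?_]
    · simp
    · ext v
      rw [List.mem_toFinset, mem_Icc]
      exact ⟨hb v, fun h => List.count_pos_iff.1 (by rw [hcount v h.1 h.2]; simp)⟩
  subst hlen
  let f : Fin L.length → Fin L.length := fun i =>
    ⟨L[i] - 1, by have := hb L[i] (List.getElem_mem _); omega⟩
  have hf : Function.Injective f := fun i j h => by
    have h1 := hb L[i] (List.getElem_mem _)
    have h2 := hb L[j] (List.getElem_mem _)
    have h3 : L[i] - 1 = L[j] - 1 := congrArg Fin.val h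
    have h4 : L[(i : ℕ)] = L[(j : ℕ)] := by simp only [Fin.getElem_fin] at *; omega
    exact Fin.ext ((hnd.getElem_inj_iff).1 h4)
  refine ⟨Equiv.ofBijective f (Finite.injective_iff_bijective.1 hf), ?_⟩
  congr 1
  refine List.ext_getElem (by simp [length_word]) fun i h1 h2 => ?_
  have := hb L[i] (List.getElem_mem _)
  simp [word, letter, f]
  omega

end Bridge

/-! ### The path model of the generating polynomial and the γ-coefficients -/

section Main

variable {R : Type*} [CommRing R]

theorem genPoly_eq_sum_gapWords (a b p q y t : R) (n : ℕ) :
    genPoly n a 1 b 1 p q y t = ((gapWords (2 * n + 2) (2 * n)).map fun s =>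
      gapWeight a b p q y t n s * if s.count (2 * n + 2) - 1 = 0 then 1 else 0).sum := by
  have hN : Even (2 * n + 2) := by simp [parity_simps]
  have hlt : 2 * n < 2 * n + 2 := by omega
  have hmem := fun s => mem_gapWords hN hlt (s := s)
  rw [← List.sum_toFinset _ (nodup_gapWords hN hlt)]
  simp only [mul_ite, mul_one, mul_zero]
  rw [← sum_filter]
  have himage : {s ∈ (gapWords (2 * n + 2) (2 * n)).toFinset | s.count (2 * n + 2) - 1 = 0} =
      (evenOddPerms n).image fun σ => word σ ++ [2 * n + 2] := by
    ext s
    simp only [mem_filter, List.mem_toFinset, hmem, mem_image]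
    constructor
    · rintro ⟨hs, hc⟩
      have := hs.count_pos
      obtain ⟨σ, rfl⟩ := hs.exists_word hlt (by omega)
      exact ⟨σ, (isGapWord_word hlt σ).1 hs, rfl⟩
    · rintro ⟨σ, hσ, rfl⟩
      refine ⟨(isGapWord_word hlt σ).2 hσ, ?_⟩
      have : 2 * n + 2 ∉ word σ := fun h => by
        obtain ⟨i, hi⟩ := (List.mem_ofFn' _ _).1 h
        have := letter_le σ i
        omega
      simp [List.count_eq_zero.2 this]
  rw [himage, sum_image fun σ _ τ _ h => word_injective (List.append_cancel_right h), genPoly]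
  exact sum_congr rfl fun σ hσ => (gapWeight_word a b p q y t hlt hσ).symm

/-- The gap words carry the first m steps of the path and `pathSum` the last k. Trading the last
inserted pair for one more path step lowers m and raises k, until only the word `[N]`, at height 0,
is left. -/
theorem sum_gapWords_pathSum (a b p q y t : R) {N : ℕ} (hN : Even N) {m : ℕ} (hm : 2 * m < N)
    (k : ℕ) :
    ((gapWords N (2 * m)).map fun s => gapWeight a b p q y t m s *
      pathSum (fun h => (1 + t * y) * (pqInt a (h + 1) p q * pqInt b (h + 1) q p))
        (fun h => pqInt a (h + 2) p q * pqInt b (h + 1) q p)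
        (fun h => t * (pqInt a (h + 1) p q * pqInt b (h + 2) q p)) k (s.count N - 1)).sum =
      pathSum (fun h => (1 + t * y) * (pqInt a (h + 1) p q * pqInt b (h + 1) q p))
        (fun h => pqInt a (h + 2) p q * pqInt b (h + 1) q p)
        (fun h => t * (pqInt a (h + 1) p q * pqInt b (h + 2) q p)) (k + m) 0 := by
  induction m generalizing k with
  | zero => simp [gapWords, gapWeight]
  | succ m ih =>
    rw [show k + (m + 1) = k + 1 + m by omega, ← ih (by omega) (k + 1),
      show gapWords N (2 * (m + 1)) = ((gapWords N (2 * m)).flatMap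
        (insertLetter N (2 * m + 1))).flatMap (insertLetter N (2 * m + 2)) from rfl,
      sum_map_flatMap, sum_map_flatMap]
    refine congrArg List.sum (List.map_congr_left fun s hs => ?_)
    have hs' := (mem_gapWords hN (by omega)).1 hs
    set T := pathSum (fun h => (1 + t * y) * (pqInt a (h + 1) p q * pqInt b (h + 1) q p))
        (fun h => pqInt a (h + 2) p q * pqInt b (h + 1) q p)
        (fun h => t * (pqInt a (h + 1) p q * pqInt b (h + 2) q p)) with hT
    rw [hs'.sum_insertLetter_insertLetter a b p q y t hN hm fun c => T k (c - 1)]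
    congr 1
    obtain ⟨c, hc⟩ : ∃ c, s.count N = c + 1 := ⟨s.count N - 1, by have := hs'.count_pos; omega⟩
    rw [hc]
    cases c with
    | zero => simp [hT, pathSum]; ring
    | succ c => simp [hT, pathSum]; ring

theorem genPoly_eq_pathSum (a b p q y t : R) (n : ℕ) :
    genPoly n a 1 b 1 p q y t =
      pathSum (fun h => (1 + t * y) * (pqInt a (h + 1) p q * pqInt b (h + 1) q p))
        (fun h => pqInt a (h + 2) p q * pqInt b (h + 1) q p)
        (fun h => t * (pqInt a (h + 1) p q * pqInt b (h + 2) q p)) n 0 := by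
  have := sum_gapWords_pathSum a b p q y t (N := 2 * n + 2) (by simp [parity_simps]) (m := n)
    (by omega) 0
  rw [zero_add] at this
  rw [genPoly_eq_sum_gapWords, ← this]
  simp only [pathSum]

theorem genPoly_eq_sum_pathCoeff (a b p q y t : R) (n : ℕ) :
    genPoly n a 1 b 1 p q y t = ∑ k ∈ range (n / 2 + 1),
      pathCoeff (fun h => pqInt a (h + 1) p q * pqInt b (h + 1) q p)
        (fun h => pqInt a (h + 2) p q * pqInt b (h + 1) q p)
        (fun h => pqInt a (h + 1) p q * pqInt b (h + 2) q p) n 0 k *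
        t ^ k * (1 + t * y) ^ (n - 2 * k) := by
  rw [genPoly_eq_pathSum, pathSum_eq_sum_pathCoeff _ _ _ _ _ (J := n + 1) (by omega)]
  symm
  refine sum_subset (range_subset_range.2 (by omega)) fun k _ hk => ?_
  rw [mem_range] at hk
  rw [pathCoeff_eq_zero _ _ _ (by omega), zero_mul, zero_mul]

theorem dom_eq_zero_iff {n : ℕ} (σ : Equiv.Perm (Fin (2 * n))) : dom σ = 0 ↔
    ∀ j ∈ Icc 1 n, ¬ (IsDescentBottom σ (2 * j - 1) ∧ IsDescentTop σ (2 * j)) := by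
  rw [dom, card_eq_zero, filter_eq_empty_iff]
  exact forall₂_congr fun j _ => not_congr and_comm

open Polynomial in
-- The factor 0 ^ `dom` is the indicator of the permutations without dominos, which are the
-- 𝓔-permutations.
theorem genPoly_zero_eq_sum_ePerms (a b p q : R) (n : ℕ) :
    genPoly n (Polynomial.C a) 1 (Polynomial.C b) 1 (Polynomial.C p) (Polynomial.C q) 0
      (Polynomial.X : R[X]) =
    ∑ σ ∈ ePerms n, Polynomial.C (a ^ lema σ * b ^ romi σ * p ^ res σ * q ^ les σ) *
      Polynomial.X ^ des σ := by
  rw [genPoly, ePerms, sum_filter]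
  refine sum_congr rfl fun σ _ => ?_
  simp only [← dom_eq_zero_iff, zero_pow_eq, map_mul, map_pow, one_pow, mul_one]
  split_ifs <;> simp

open Polynomial in
-- The path expansion holds over every commutative ring. Over `R[X]` with y = 0 and t = X, the
-- factors 1 + ty become 1, and the coefficients of X^k can be compared.
theorem gammaCoeff_eq_pathCoeff (a b p q : R) {n k : ℕ} (hk : k < n / 2 + 1) :
    gammaCoeff n k a b p q = pathCoeff (fun h => pqInt a (h + 1) p q * pqInt b (h + 1) q p)
        (fun h => pqInt a (h + 2) p q * pqInt b (h + 1) q p)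
        (fun h => pqInt a (h + 1) p q * pqInt b (h + 2) q p) n 0 k := by
  have hC (x p q : R) (n : ℕ) : pqInt (Polynomial.C x) n (Polynomial.C p) (Polynomial.C q) =
      Polynomial.C (pqInt x n p q) := by simp [pqInt]
  have h := genPoly_eq_sum_pathCoeff (Polynomial.C a) (Polynomial.C b) (Polynomial.C p)
    (Polynomial.C q) 0 (Polynomial.X : R[X]) n
  simp only [genPoly_zero_eq_sum_ePerms, hC, ← map_mul, ← map_pathCoeff, mul_zero, add_zero,
    one_pow, mul_one] at h
  have h2 := congrArg (fun P => Polynomial.coeff P k) h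
  simp only [Polynomial.finsetSum_coeff, Polynomial.coeff_C_mul_X_pow] at h2
  rw [sum_ite_eq, if_pos (mem_range.2 hk), ← sum_filter] at h2
  rw [gammaCoeff, ← h2]
  exact sum_congr (filter_congr fun σ _ => eq_comm) fun _ _ => rfl

end Main

end EvenOdd

theorem mainTheorem4 {R : Type*} [CommRing R] (a b p q y t : R) :
    EvenOdd.HasJFraction
      (PowerSeries.mk fun n : ℕ => if n = 0 then 1 else EvenOdd.genPoly n a 1 b 1 p q y t)
      (fun n => (1 + t * y) * EvenOdd.pqInt a (n + 1) p q * EvenOdd.pqInt b (n + 1) q p)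
      (fun n => t * EvenOdd.pqInt a n p q * EvenOdd.pqInt a (n + 1) p q *
        EvenOdd.pqInt b n q p * EvenOdd.pqInt b (n + 1) q p) ∧
    ∀ n : ℕ, EvenOdd.genPoly n a 1 b 1 p q y t =
      ∑ k ∈ Finset.range (n / 2 + 1),
        EvenOdd.gammaCoeff n k a b p q * t ^ k * (1 + y * t) ^ (n - 2 * k) := by
  constructor
  · convert! EvenOdd.hasJFraction_pathSeries
      (β := fun h => (1 + t * y) * (EvenOdd.pqInt a (h + 1) p q * EvenOdd.pqInt b (h + 1) q p))
      (U := fun h => EvenOdd.pqInt a (h + 2) p q * EvenOdd.pqInt b (h + 1) q p)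
      (D := fun h => t * (EvenOdd.pqInt a (h + 1) p q * EvenOdd.pqInt b (h + 2) q p))
      (lam := fun n => t * EvenOdd.pqInt a n p q * EvenOdd.pqInt a (n + 1) p q *
        EvenOdd.pqInt b n q p * EvenOdd.pqInt b (n + 1) q p) (fun k => by ring) using 1
    · ext n
      rw [EvenOdd.pathSeries, PowerSeries.coeff_mk, PowerSeries.coeff_mk,
        ← EvenOdd.genPoly_eq_pathSum]
      -- The prescribed constant term 1 agrees with `genPoly 0`, which counts the empty path.
      split_ifs with h
      · subst h
        simp [EvenOdd.genPoly_eq_pathSum, EvenOdd.pathSum]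
      · rfl
    · ext n; ring
  · intro n
    rw [EvenOdd.genPoly_eq_sum_pathCoeff]
    refine Finset.sum_congr rfl fun k hk => ?_
    rw [EvenOdd.gammaCoeff_eq_pathCoeff a b p q (Finset.mem_range.1 hk), mul_comm y t]
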